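/- **Setting.** For $A\in\mathbb R^{k\times n}$ and $W_\sharp\in\mathbb R^{m\times k}$ let $\mathcal L(W)=\frac1{2n}\|WA-W_\sharp A\|_F^2$ for $W\in\mathbb R^{m\times k}$, and let $B=\frac1nAA^\top$. Gradient descent is $W_0=0$, $W_{t+1}=W_t-\eta\nabla\mathcal L(W_t)$ with $\eta=\frac1{c\|B\|_{\rm op}}$. Write $\|\cdot\|_{\rm op},\|\cdot\|_F,\|\cdot\|_*$ for the operator, Frobenius and nuclear norms, and $\mathrm{nr}(G)=\|G\|_*^2/\|G\|_F^2$. Fix constants $0<c_1\le c_2$, $c\ge1$, $\ell,u>0$. For $d,r\in\mathbb N$ say that $B$ is *$(d,r)$-multi-spiked* if $B=S+\Sigma$ with $S,\Sigma\in\mathbb R^{k\times k}$ symmetric, $\operatorname{rank}S=r$, all nonzero eigenvalues of $S$ in $[c_1d^\ell,c_2d^u]$, $c_1I_k\preceq\Sigma\preceq c_2I_k$, and moreover $\|B\|_{\rm op}\ge c_1d^u$. **Theorem (multi-step gradient descent, realizable multi-spike model).** There is a constant $C_1>0$, depending only on $c_1,c_2,c,\ell,u$, such that for every constant $C_2>0$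 the following two statements hold. 1. For every $K$ there are constants $a,b>0$ such that for all sufficiently large $d$: for all $m,k,n,r$, every $A$ such that $B$ is $(d,r)$-multi-spiked, every $W_\sharp$ with $\|W_\sharp\|_{\rm op}\le K$, and every orthogonal $U$ with $B=U\operatorname{diag}(\lambda_1\ge\dots\ge\lambda_k)U^\top$, the matrix $\overline M\in\mathbb R^{m\times(k-r)}$ formed by the last $k-r$ columns of $W_\sharp U$ satisfies $$\|\nabla\mathcal L(W_t)\|_*\ \ge\ a\,\bigl(\|\overline M\|_*-r\bigr),\qquad \|\nabla\mathcal L(W_t)\|_F\ \le\ b\,\bigl(\|\overline M\|_F+\sqrt r\bigr)$$ for every integer $t$ with $C_1d^{u-\ell}\log d\le t\le C_2d^u$. 2. (Gaussian ground truth.) For all constants $0<\kappa_1\le\kappa_2$ there is a constant $C_3>0$ such that, in the regime $\kappa_1d\le m,k\le\kappa_2d$ and $r=o(d)$, if $B$ is $(d,r)$-multi-spiked and $W_\sharp$ has i.i.d. $\mathcal N(0,\frac1d)$ entries independent of $A$, then conditionally on $A$ (that is, for each fixed $A$, and uniformly over all such $A$), with probability tending to one as $d\to\infty$, $$\mathrm{nr}(\nabla\mathcal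 L(W_t))\ \ge\ C_3d\qquad\text{for all integers }t\text{ with } C_1d^{u-\ell}\log d\le t\le C_2d^u .$$ -/

import Mathlib

open Filter Topology MeasureTheory ProbabilityTheory
open scoped NNReal Matrix

noncomputable section

namespace MultiSpike

/-- Operator norm induced by the Euclidean norms. -/
def opNorm {m k : ℕ} (M : Matrix (Fin m) (Fin k) ℝ) : ℝ :=
  ‖(Matrix.toEuclideanLin M).toContinuousLinearMap‖

/-- Frobenius norm. -/
def frobNorm {p q : Type*} [Fintype p] [Fintype q] (M : Matrix p q ℝ) : ℝ :=
  √(∑ i, ∑ j, M i j ^ 2)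

/-- Nuclear norm: the sum of the singular values. (Mathlib's sequence of singular values of a
linear map is zero from the dimension of its domain on.) -/
def nucNorm {p q : Type*} [Fintype p] [Fintype q] [DecidableEq q] (M : Matrix p q ℝ) : ℝ :=
  ∑ i ∈ Finset.range (Fintype.card q), (Matrix.toEuclideanLin M).singularValues i

/-- Nuclear rank `‖G‖_*² / ‖G‖_F²`. -/
def nuclearRank {m k : ℕ} (G : Matrix (Fin m) (Fin k) ℝ) : ℝ :=
  nucNorm G ^ 2 / frobNorm G ^ 2

/-- The Gram matrix `B = (1/n) A Aᵀ`. -/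
def gram {k n : ℕ} (A : Matrix (Fin k) (Fin n) ℝ) : Matrix (Fin k) (Fin k) ℝ :=
  (1 / (n : ℝ)) • (A * Aᵀ)

/-- The loss `L(W) = (1/2n) ‖W A - Y‖_F²` with realizable labels `Y = W♯ A`. -/
def loss {m k n : ℕ} (A : Matrix (Fin k) (Fin n) ℝ) (Wsharp W : Matrix (Fin m) (Fin k) ℝ) : ℝ :=
  1 / (2 * (n : ℝ)) * frobNorm (W * A - Wsharp * A) ^ 2

/-- Gradient of a function of a matrix: the matrix of its partial derivatives. -/
def matGrad {m k : ℕ} (f : Matrix (Fin m) (Fin k) ℝ → ℝ) (W : Matrix (Fin m) (Fin k) ℝ) :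
    Matrix (Fin m) (Fin k) ℝ :=
  Matrix.of fun i j => deriv (fun s : ℝ => f (W + s • Matrix.single i j (1 : ℝ))) 0

/-- Gradient descent on `f` with step size `η`, started at the zero matrix. -/
def gdIter {m k : ℕ} (f : Matrix (Fin m) (Fin k) ℝ → ℝ) (η : ℝ) : ℕ → Matrix (Fin m) (Fin k) ℝ
  | 0 => 0
  | t + 1 => gdIter f η t - η • matGrad f (gdIter f η t)

/-- `∇L(W_t)` along gradient descent on the loss, with step size `η = 1 / (c ‖B‖_op)`. -/
def gradAt {m k n : ℕ} (c : ℝ) (A : Matrix (Fin k) (Fin n) ℝ) (Wsharp : Matrix (Fin m) (Fin k) ℝ)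
    (t : ℕ) : Matrix (Fin m) (Fin k) ℝ :=
  matGrad (loss A Wsharp) (gdIter (loss A Wsharp) (1 / (c * opNorm (gram A))) t)

/-- `B = S + Σ` with symmetric `S, Σ`, where `S` has rank `r` and its nonzero eigenvalues lie in
`[c₁ d^ℓ, c₂ d^u]`, and `c₁ I ≼ Σ ≼ c₂ I`. -/
def MultiSpiked (c₁ c₂ ℓ u : ℝ) (d r : ℕ) {k : ℕ} (B : Matrix (Fin k) (Fin k) ℝ) : Prop :=
  ∃ S Sig : Matrix (Fin k) (Fin k) ℝ,
    B = S + Sig ∧ S.IsSymm ∧ Sig.IsSymm ∧ S.rank = r ∧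
    (∀ μ ∈ spectrum ℝ S, μ ≠ 0 → c₁ * (d : ℝ) ^ ℓ ≤ μ ∧ μ ≤ c₂ * (d : ℝ) ^ u) ∧
    (Sig - c₁ • (1 : Matrix (Fin k) (Fin k) ℝ)).PosSemidef ∧
    (c₂ • (1 : Matrix (Fin k) (Fin k) ℝ) - Sig).PosSemidef

/-- `U` is an orthogonal factor in an eigenvalue decomposition `B = U diag(lam) Uᵀ` whose
eigenvalues are listed in decreasing order. -/
def IsOrderedEigenbasis {k : ℕ} (B U : Matrix (Fin k) (Fin k) ℝ) : Prop :=
  U ∈ Matrix.orthogonalGroup (Fin k) ℝ ∧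
    ∃ lam : Fin k → ℝ, Antitone lam ∧ B = U * Matrix.diagonal lam * Uᵀ

/-- All columns of `M` but the first `r`. -/
def lastCols {m k : ℕ} (r : ℕ) (M : Matrix (Fin m) (Fin k) ℝ) :
    Matrix (Fin m) {j : Fin k // r ≤ (j : ℕ)} ℝ :=
  M.submatrix id Subtype.val

/-- `C₁ d^(u-ℓ) log d ≤ t ≤ C₂ d^u`. -/
def InWindow (C₁ C₂ ℓ u : ℝ) (d t : ℕ) : Prop :=
  C₁ * (d : ℝ) ^ (u - ℓ) * Real.log d ≤ t ∧ (t : ℝ) ≤ C₂ * (d : ℝ) ^ u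

/-- The random matrix `W` has i.i.d. entries of law `N(0, v)`. -/
def IsGaussianMatrix {Ω : Type*} [MeasurableSpace Ω] (P : Measure Ω) {m k : ℕ} (v : ℝ≥0)
    (W : Ω → Matrix (Fin m) (Fin k) ℝ) : Prop :=
  (∀ i j, HasLaw (fun ω => W ω i j) (gaussianReal 0 v) P) ∧
    iIndepFun (fun (p : Fin m × Fin k) ω => W ω p.1 p.2) P

end MultiSpike

end

/-! The loss is quadratic, so gradient descent is linear: writing `B = U diag(lam) Uᵀ`, the gradient
at time `t` is `-(W♯ U) D Uᵀ` with `D` diagonal and `D j = lam j * (1 - η * lam j) ^ t`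
(`gradAt_eq`). Everything follows from the size of this filter in the time window. By min-max
arguments (`MultiSpiked.eigenvalues`) the last `k - r` eigenvalues lie in `[c₁, c₂]` and the first
`r` are at least `c₁ d^ℓ`. As `η` is of order `d^(-u)`, the condition `t ≤ C₂ d^u` keeps `η lam t`
bounded on the bulk, so `D` stays above a constant `a` there. On the spikes `t ≥ C₁ d^(u-ℓ) log d`
forces `(1 - η lam)^t ≤ d^(-u)`, which cancels the possible size `d^u` of `lam`. Hence `|D| ≤ 2 c₂`
everywhere (`filter_bounds`, `gradAt_window`).

For the deterministic estimates, the nuclear norm is bounded below by trace duality, testing against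
a matrix supported on the bulk columns (`nucNorm_lastCols_le`). The Frobenius norm is bounded
columnwise, each of the `r` spike columns of `W♯ U` having norm at most `K`.

For Gaussian `W♯`, Hölder's inequality for Schatten norms gives `nr(G) ≥ ‖G‖_F⁴ / ‖GᵀG‖_F²`
(`nuclearRank_ge`), so no control of individual singular values is needed. The filter bounds reduce
this to a lower bound of order `d` on the energy of the bulk columns of `W♯ U` and an upper bound of
order `d` on `‖W♯ W♯ᵀ‖_F²`. Both hold with high probability by Markov and Chebyshev
(`prob_good_ge`). This event does not involve `t`, so it serves the whole window at once. -/

noncomputable section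

namespace MultiSpike

/-! ### Nuclear norm: singular values, Hölder's inequality, trace duality. -/

section NuclearNorm

variable {p q : Type*} [Fintype p] [Fintype q] [DecidableEq q]

/-- Serves to identify the eigenvalues of the operator `M* M`, which define the singular values,
with those of the matrix `Mᵀ M`. -/
theorem eigenvalues_congr {E : Type*} [NormedAddCommGroup E] [InnerProductSpace ℝ E]
    [FiniteDimensional ℝ E] {T T' : E →ₗ[ℝ] E} (h : T = T') (hT : T.IsSymmetric)
    (hT' : T'.IsSymmetric) {n : ℕ} (hn : Module.finrank ℝ E = n) :
    hT.eigenvalues hn = hT'.eigenvalues hn := by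
  subst h; rfl

/-- A right orthogonal factor of a singular value decomposition. -/
theorem exists_singular_basis (M : Matrix p q ℝ) :
    ∃ (V : Matrix q q ℝ) (s : q → ℝ), (∀ i, 0 ≤ s i) ∧ Vᵀ * V = 1 ∧ V * Vᵀ = 1 ∧
      Mᵀ * M = V * Matrix.diagonal (fun i => s i ^ 2) * Vᵀ ∧ nucNorm M = ∑ i, s i := by
  classical
  have hH : (Mᵀ * M).IsHermitian := by
    simpa using Matrix.isHermitian_conjTranspose_mul_self M
  have hP : (Mᵀ * M).PosSemidef := by
    simpa using Matrix.posSemidef_conjTranspose_mul_self M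
  refine ⟨hH.eigenvectorUnitary, fun i => √(hH.eigenvalues i), fun i => Real.sqrt_nonneg _,
    ?_, ?_, ?_, ?_⟩
  · simpa [Matrix.star_eq_conjTranspose] using
      Unitary.coe_star_mul_self hH.eigenvectorUnitary
  · simpa [Matrix.star_eq_conjTranspose] using
      Unitary.coe_mul_star_self hH.eigenvectorUnitary
  · have h := hH.spectral_theorem
    rw [Unitary.conjStarAlgAut_apply] at h
    have h2 : (fun i => √(hH.eigenvalues i) ^ 2) = RCLike.ofReal ∘ hH.eigenvalues := by
      funext i
      simpa using Real.sq_sqrt (hP.eigenvalues_nonneg i)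
    rw [h2]
    simpa [Matrix.star_eq_conjTranspose] using h
  · have hadj : (Matrix.toEuclideanLin M).adjoint ∘ₗ (Matrix.toEuclideanLin M) =
        Matrix.toEuclideanLin (Mᵀ * M) := by
      rw [← Matrix.toEuclideanLin_conjTranspose_eq_adjoint]
      ext v i
      simp [Matrix.toLpLin_apply, Matrix.mulVec_mulVec]
    rw [nucNorm, Finset.sum_range]
    have hfin : Module.finrank ℝ (EuclideanSpace ℝ q) = Fintype.card q := finrank_euclideanSpace
    have key : ∀ i : Fin (Fintype.card q), (Matrix.toEuclideanLin M).singularValues i =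
        √(hH.eigenvalues₀ i) := by
      intro i
      have h1 := LinearMap.singularValues_fin (Matrix.toEuclideanLin M) hfin i
      have h2 := eigenvalues_congr hadj
        (Matrix.toEuclideanLin M).isSymmetric_adjoint_comp_self
        (Matrix.isSymmetric_toEuclideanLin_iff.mpr hH) hfin
      rw [h1, h2, Matrix.IsHermitian.eigenvalues₀]
    simp_rw [key]
    exact (Equiv.sum_comp (Fintype.equivOfCardEq (Fintype.card_fin _)).symm
      (fun i => √(hH.eigenvalues₀ i))).symm

theorem mulVec_dotProduct_mulVec_self {p q : Type*} [Fintype p] [Fintype q] (Y : Matrix p q ℝ) (v : q → ℝ) :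
    (Y *ᵥ v) ⬝ᵥ (Y *ᵥ v) = v ⬝ᵥ ((Yᵀ * Y) *ᵥ v) := by
  rw [Matrix.dotProduct_mulVec, ← Matrix.mulVec_transpose, Matrix.mulVec_mulVec,
    dotProduct_comm]

theorem dotProduct_mulVec_conj_diagonal (V : Matrix q q ℝ) (e : q → ℝ) (v : q → ℝ) :
    v ⬝ᵥ ((V * Matrix.diagonal e * Vᵀ) *ᵥ v) = ∑ i, e i * (Vᵀ *ᵥ v) i ^ 2 := by
  rw [← Matrix.mulVec_mulVec, ← Matrix.mulVec_mulVec, Matrix.dotProduct_mulVec,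
    ← Matrix.mulVec_transpose]
  simp only [dotProduct, Matrix.mulVec_diagonal]
  exact Finset.sum_congr rfl fun i _ => by ring

theorem dotProduct_self_eq_sum_of_orthogonal {V : Matrix q q ℝ} (hV : V * Vᵀ = 1) (v : q → ℝ) :
    v ⬝ᵥ v = ∑ i, (Vᵀ *ᵥ v) i ^ 2 := by
  have := dotProduct_mulVec_conj_diagonal V (fun _ => 1) v
  simpa [hV] using this

theorem frobNorm_sq {p q : Type*} [Fintype p] [Fintype q] (M : Matrix p q ℝ) :
    frobNorm M ^ 2 = ∑ i, ∑ j, M i j ^ 2 :=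
  Real.sq_sqrt (Finset.sum_nonneg fun _ _ => Finset.sum_nonneg fun _ _ => sq_nonneg _)

theorem frobNorm_nonneg {p q : Type*} [Fintype p] [Fintype q] (M : Matrix p q ℝ) :
    0 ≤ frobNorm M := Real.sqrt_nonneg _

theorem frobNorm_sq_eq_trace {p q : Type*} [Fintype p] [Fintype q] (M : Matrix p q ℝ) :
    frobNorm M ^ 2 = (Mᵀ * M).trace := by
  rw [frobNorm_sq, Finset.sum_comm]
  simp [Matrix.trace, Matrix.mul_apply, sq]

theorem frobNorm_sq_eq_sum_sq {M : Matrix p q ℝ} {V : Matrix q q ℝ} {s : q → ℝ}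
    (hV : Vᵀ * V = 1) (hM : Mᵀ * M = V * Matrix.diagonal (fun i => s i ^ 2) * Vᵀ) :
    frobNorm M ^ 2 = ∑ i, s i ^ 2 := by
  rw [frobNorm_sq_eq_trace, hM, Matrix.trace_mul_comm, ← Matrix.mul_assoc, hV, Matrix.one_mul,
    Matrix.trace_diagonal]

theorem frobNorm_gram_sq_eq_sum {M : Matrix p q ℝ} {V : Matrix q q ℝ} {s : q → ℝ}
    (hV : Vᵀ * V = 1) (hM : Mᵀ * M = V * Matrix.diagonal (fun i => s i ^ 2) * Vᵀ) :
    frobNorm (Mᵀ * M) ^ 2 = ∑ i, s i ^ 4 := by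
  rw [frobNorm_sq_eq_trace, Matrix.transpose_mul, Matrix.transpose_transpose, hM]
  have : V * Matrix.diagonal (fun i => s i ^ 2) * Vᵀ *
      (V * Matrix.diagonal (fun i => s i ^ 2) * Vᵀ) =
      V * Matrix.diagonal (fun i => s i ^ 4) * Vᵀ := by
    calc _ = V * Matrix.diagonal (fun i => s i ^ 2) * (Vᵀ * V) *
          Matrix.diagonal (fun i => s i ^ 2) * Vᵀ := by simp only [Matrix.mul_assoc]
      _ = _ := by
          rw [hV, Matrix.mul_one, Matrix.mul_assoc V, Matrix.diagonal_mul_diagonal]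
          simp [← pow_add]
  rw [this, Matrix.trace_mul_comm, ← Matrix.mul_assoc, hV, Matrix.one_mul,
    Matrix.trace_diagonal]

/-- Hölder's inequality between the Schatten norms of orders `1`, `2` and `4`. -/
theorem frobNorm_pow_six_le (M : Matrix p q ℝ) :
    (frobNorm M ^ 2) ^ 3 ≤ nucNorm M ^ 2 * frobNorm (Mᵀ * M) ^ 2 := by
  obtain ⟨V, s, hs, hV, -, hM, hn⟩ := exists_singular_basis M
  rw [frobNorm_sq_eq_sum_sq hV hM, frobNorm_gram_sq_eq_sum hV hM, hn]
  -- Cauchy–Schwarz twice, interpolating through the third power sum, which is then eliminated.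
  have h1 : (∑ i, s i ^ 2) ^ 2 ≤ (∑ i, s i) * ∑ i, s i ^ 3 :=
    Finset.sum_sq_le_sum_mul_sum_of_sq_le_mul _ (fun i _ => hs i)
      (fun i _ => pow_nonneg (hs i) 3) (fun i _ => (by ring : _ = _).le)
  have h2 : (∑ i, s i ^ 3) ^ 2 ≤ (∑ i, s i ^ 2) * ∑ i, s i ^ 4 :=
    Finset.sum_sq_le_sum_mul_sum_of_sq_le_mul _ (fun i _ => pow_nonneg (hs i) 2)
      (fun i _ => pow_nonneg (hs i) 4) (fun i _ => (by ring : _ = _).le)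
  have h0 : 0 ≤ ∑ i, s i ^ 2 := Finset.sum_nonneg fun i _ => sq_nonneg _
  rcases h0.eq_or_lt with h | h
  · rw [← h]
    have : 0 ≤ ∑ i, s i ^ 4 := Finset.sum_nonneg fun i _ => pow_nonneg (hs i) 4
    rw [zero_pow three_ne_zero]
    positivity
  · have h3 := pow_le_pow_left₀ (sq_nonneg _) h1 2
    refine le_of_mul_le_mul_left ?_ h
    calc (∑ i, s i ^ 2) * (∑ i, s i ^ 2) ^ 3 = ((∑ i, s i ^ 2) ^ 2) ^ 2 := by ring
      _ ≤ (∑ i, s i) ^ 2 * (∑ i, s i ^ 3) ^ 2 := by rw [← mul_pow]; exact h3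
      _ ≤ (∑ i, s i) ^ 2 * ((∑ i, s i ^ 2) * ∑ i, s i ^ 4) := by gcongr
      _ = _ := by ring

/-- Dividing the Hölder inequality by `‖G‖_F²` leaves only a lower bound on the second and an upper
bound on the fourth Schatten norm to be found. -/
theorem nuclearRank_ge {m k : ℕ} (G : Matrix (Fin m) (Fin k) ℝ) {x y : ℝ} (hx : 0 < x)
    (hF : x ≤ frobNorm G ^ 2) (hQ : frobNorm (Gᵀ * G) ^ 2 ≤ y) :
    x ^ 2 / y ≤ nuclearRank G := by
  have h6 := frobNorm_pow_six_le G
  have hFpos : 0 < frobNorm G ^ 2 := hx.trans_le hF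
  have hQpos : 0 < frobNorm (Gᵀ * G) ^ 2 := by
    refine lt_of_le_of_ne (sq_nonneg _) fun h => ?_
    rw [← h, mul_zero] at h6
    exact absurd h6 (not_le.mpr (pow_pos hFpos 3))
  have hy := hQpos.trans_le hQ
  rw [nuclearRank, div_le_div_iff₀ hy hFpos]
  calc x ^ 2 * frobNorm G ^ 2 ≤ (frobNorm G ^ 2) ^ 2 * frobNorm G ^ 2 := by gcongr
    _ = (frobNorm G ^ 2) ^ 3 := by ring
    _ ≤ _ := h6.trans (by gcongr)

/-- Duality bound: `⟨M, Y⟩ ≤ L ‖M‖_*` if `Y` has operator norm at most `L`. -/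
theorem trace_transpose_mul_le (M Y : Matrix p q ℝ) {L : ℝ} (hL : 0 ≤ L)
    (hY : ∀ v : q → ℝ, (Y *ᵥ v) ⬝ᵥ (Y *ᵥ v) ≤ L ^ 2 * (v ⬝ᵥ v)) :
    (Mᵀ * Y).trace ≤ L * nucNorm M := by
  obtain ⟨V, s, hs, hV, hV', hM, hn⟩ := exists_singular_basis M
  have hcol : ∀ i, Vᵀ i ⬝ᵥ Vᵀ i = 1 := by
    intro i
    have := congrFun (congrFun hV i) i
    simpa [Matrix.mul_apply, dotProduct] using this
  have hMV : (M * V)ᵀ * (M * V) = Matrix.diagonal (fun i => s i ^ 2) := by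
    calc (M * V)ᵀ * (M * V) = Vᵀ * (Mᵀ * M) * V := by
          rw [Matrix.transpose_mul]; simp only [Matrix.mul_assoc]
      _ = (Vᵀ * V) * Matrix.diagonal (fun i => s i ^ 2) * (Vᵀ * V) := by
          rw [hM]; simp only [Matrix.mul_assoc]
      _ = _ := by rw [hV, Matrix.one_mul, Matrix.mul_one]
  have hMcol : ∀ i, ∑ a, (M * V) a i ^ 2 = s i ^ 2 := by
    intro i
    have := congrFun (congrFun hMV i) i
    rw [Matrix.mul_apply, Matrix.diagonal_apply_eq] at this
    rw [← this]
    exact Finset.sum_congr rfl fun a _ => sq _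
  have hYcol : ∀ i, ∑ a, (Y * V) a i ^ 2 ≤ L ^ 2 := by
    intro i
    have h := hY (Vᵀ i)
    rw [hcol, mul_one] at h
    convert h using 1
    simp [dotProduct, Matrix.mul_apply, Matrix.mulVec, sq]
  -- In the basis `V` the trace splits into inner products of columns; the columns of `M V` have
  -- norm `s i`, those of `Y V` at most `L`.
  have htr : (Mᵀ * Y).trace = ∑ i, ∑ a, (M * V) a i * (Y * V) a i := by
    have : (Mᵀ * Y).trace = ((M * V)ᵀ * (Y * V)).trace := by
      rw [Matrix.transpose_mul, Matrix.mul_assoc, Matrix.trace_mul_comm Vᵀ, ← Matrix.mul_assoc,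
        Matrix.mul_assoc _ V, hV', Matrix.mul_one]
    rw [this]
    simp only [Matrix.trace, Matrix.diag_apply, Matrix.mul_apply (M := (M * V)ᵀ),
      Matrix.transpose_apply (M * V)]
  rw [htr, hn, Finset.mul_sum]
  refine Finset.sum_le_sum fun i _ => ?_
  refine le_trans (Real.sum_mul_le_sqrt_mul_sqrt _ _ _) ?_
  rw [hMcol, Real.sqrt_sq (hs i), mul_comm L]
  gcongr
  · exact hs i
  · exact (Real.sqrt_le_sqrt (hYcol i)).trans (Real.sqrt_sq hL).le

/-- The duality bound is attained. -/
theorem exists_trace_eq_nucNorm (M : Matrix p q ℝ) :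
    ∃ Y : Matrix p q ℝ, (∀ v : q → ℝ, (Y *ᵥ v) ⬝ᵥ (Y *ᵥ v) ≤ v ⬝ᵥ v) ∧
      (Mᵀ * Y).trace = nucNorm M := by
  obtain ⟨V, s, hs, hV, hV', hM, hn⟩ := exists_singular_basis M
  -- The polar factor of `M`. The convention `0⁻¹ = 0` makes it vanish on the kernel, hence a
  -- partial isometry.
  refine ⟨M * V * Matrix.diagonal (fun i => (s i)⁻¹) * Vᵀ, fun v => ?_, ?_⟩
  · have hYY : (M * V * Matrix.diagonal (fun i => (s i)⁻¹) * Vᵀ)ᵀ *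
        (M * V * Matrix.diagonal (fun i => (s i)⁻¹) * Vᵀ) =
        V * Matrix.diagonal (fun i => (s i)⁻¹ * s i ^ 2 * (s i)⁻¹) * Vᵀ := by
      simp only [Matrix.transpose_mul, Matrix.transpose_transpose, Matrix.diagonal_transpose]
      calc _ = V * Matrix.diagonal (fun i => (s i)⁻¹) * Vᵀ * (Mᵀ * M) * V *
            Matrix.diagonal (fun i => (s i)⁻¹) * Vᵀ := by simp only [Matrix.mul_assoc]
        _ = V * Matrix.diagonal (fun i => (s i)⁻¹) * (Vᵀ * V) *
            Matrix.diagonal (fun i => (s i) ^ 2) * (Vᵀ * V) *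
            Matrix.diagonal (fun i => (s i)⁻¹) * Vᵀ := by
            rw [hM]; simp only [Matrix.mul_assoc]
        _ = V * (Matrix.diagonal (fun i => (s i)⁻¹) * Matrix.diagonal (fun i => (s i) ^ 2) *
            Matrix.diagonal (fun i => (s i)⁻¹)) * Vᵀ := by
            rw [hV]; simp only [Matrix.mul_assoc, Matrix.one_mul]
        _ = _ := by simp only [Matrix.diagonal_mul_diagonal]
    rw [mulVec_dotProduct_mulVec_self, hYY, dotProduct_mulVec_conj_diagonal,
      dotProduct_self_eq_sum_of_orthogonal hV' v]
    refine Finset.sum_le_sum fun i _ => ?_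
    refine mul_le_of_le_one_left (sq_nonneg _) ?_
    rcases eq_or_ne (s i) 0 with h | h
    · simp [h]
    · exact le_of_eq (by field_simp)
  · rw [hn, show Mᵀ * (M * V * Matrix.diagonal (fun i => (s i)⁻¹) * Vᵀ) =
      (Mᵀ * M) * V * Matrix.diagonal (fun i => (s i)⁻¹) * Vᵀ by simp only [Matrix.mul_assoc],
      Matrix.trace_mul_comm, hM, show Vᵀ * (V * Matrix.diagonal (fun i => s i ^ 2) * Vᵀ * V *
        Matrix.diagonal fun i => (s i)⁻¹) = (Vᵀ * V) * Matrix.diagonal (fun i => s i ^ 2) *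
        (Vᵀ * V) * Matrix.diagonal (fun i => (s i)⁻¹) by simp only [Matrix.mul_assoc], hV,
      Matrix.one_mul, Matrix.mul_one, Matrix.diagonal_mul_diagonal, Matrix.trace_diagonal]
    refine Finset.sum_congr rfl fun i _ => ?_
    rcases eq_or_ne (s i) 0 with h | h
    · simp [h]
    · field_simp

end NuclearNorm

/-! ### Closed form of the gradient along gradient descent. -/

section Gradient

/-- Along each coordinate direction the loss is a quadratic polynomial in `s`, whose derivative at
`0` is read off. -/
theorem matGrad_loss {m k n : ℕ} (A : Matrix (Fin k) (Fin n) ℝ)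
    (Wsharp W : Matrix (Fin m) (Fin k) ℝ) :
    matGrad (loss A Wsharp) W = (W - Wsharp) * gram A := by
  ext i j
  set R := W * A - Wsharp * A with hR
  have hfun : (fun s : ℝ => loss A Wsharp (W + s • Matrix.single i j (1 : ℝ))) =
      fun s => 1 / (2 * (n : ℝ)) *
        ∑ a, ∑ b, (R a b + s * (Matrix.single i j (1 : ℝ) * A) a b) ^ 2 := by
    funext s
    rw [loss, frobNorm_sq]
    congr 1
    refine Finset.sum_congr rfl fun a _ => Finset.sum_congr rfl fun b _ => ?_
    rw [Matrix.add_mul, Matrix.smul_mul, hR]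
    simp only [Matrix.sub_apply, Matrix.add_apply, Matrix.smul_apply, smul_eq_mul]
    ring
  have hder : HasDerivAt (fun s : ℝ => 1 / (2 * (n : ℝ)) *
        ∑ a, ∑ b, (R a b + s * (Matrix.single i j (1 : ℝ) * A) a b) ^ 2)
      (1 / (2 * (n : ℝ)) * ∑ a, ∑ b, 2 * R a b * (Matrix.single i j (1 : ℝ) * A) a b) 0 := by
    refine HasDerivAt.const_mul _ (HasDerivAt.fun_sum fun a _ => HasDerivAt.fun_sum fun b _ => ?_)
    have h := (((hasDerivAt_id (0 : ℝ)).mul_const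
      ((Matrix.single i j (1 : ℝ) * A) a b)).const_add (R a b)).pow 2
    refine h.congr_deriv ?_
    simp
  have hrow : ∑ a, ∑ b, 2 * R a b * (Matrix.single i j (1 : ℝ) * A) a b =
      2 * (R * Aᵀ) i j := by
    rw [Finset.sum_eq_single i, Matrix.mul_apply, Finset.mul_sum]
    · exact Finset.sum_congr rfl fun b _ => by simp [mul_assoc]
    · intro a _ ha
      exact Finset.sum_eq_zero fun b _ => by simp [ha]
    · simp
  rw [matGrad, Matrix.of_apply, hfun, hder.deriv, hrow, gram, Matrix.mul_smul,
    ← Matrix.mul_assoc, Matrix.sub_mul W Wsharp A, ← hR, Matrix.smul_apply, smul_eq_mul, ← mul_assoc]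
  congr 1
  -- For `n = 0` both normalising factors are `0` by the convention on division.
  rcases eq_or_ne (n : ℝ) 0 with h | h
  · simp [h]
  · field_simp

/-- Each step multiplies the error `W_t - W♯` on the right by `1 - η B`. -/
theorem gdIter_loss {m k n : ℕ} (A : Matrix (Fin k) (Fin n) ℝ)
    (Wsharp : Matrix (Fin m) (Fin k) ℝ) (η : ℝ) (t : ℕ) :
    gdIter (loss A Wsharp) η t - Wsharp = -(Wsharp * (1 - η • gram A) ^ t) := by
  induction t with
  | zero => simp [gdIter]
  | succ t ih =>
    rw [gdIter, matGrad_loss, sub_right_comm, ih, pow_succ, ← Matrix.mul_assoc]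
    simp only [Matrix.mul_sub, Matrix.mul_one, Matrix.mul_smul, Matrix.neg_mul, smul_neg]
    abel

theorem pow_one_sub_smul_conj {k : ℕ} {U : Matrix (Fin k) (Fin k) ℝ} (hU : Uᵀ * U = 1)
    (hU' : U * Uᵀ = 1) (lam : Fin k → ℝ) (η : ℝ) (t : ℕ) :
    (1 - η • (U * Matrix.diagonal lam * Uᵀ)) ^ t =
      U * Matrix.diagonal (fun j => (1 - η * lam j) ^ t) * Uᵀ := by
  have h1 : 1 - η • (U * Matrix.diagonal lam * Uᵀ) =
      U * Matrix.diagonal (fun j => 1 - η * lam j) * Uᵀ := by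
    have : Matrix.diagonal (fun j => 1 - η * lam j) = 1 - η • Matrix.diagonal lam := by
      rw [← Matrix.diagonal_one, ← Matrix.diagonal_smul, Matrix.diagonal_sub]
      rfl
    rw [this, Matrix.mul_sub, Matrix.sub_mul, Matrix.mul_one, hU']
    simp
  induction t with
  | zero => simp [hU']
  | succ t ih =>
    rw [pow_succ, ih, h1]
    calc _ = U * Matrix.diagonal (fun j => (1 - η * lam j) ^ t) * (Uᵀ * U) *
          Matrix.diagonal (fun j => 1 - η * lam j) * Uᵀ := by simp only [Matrix.mul_assoc]
      _ = _ := by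
        rw [hU, Matrix.mul_one, Matrix.mul_assoc U, Matrix.diagonal_mul_diagonal]
        simp [pow_succ]

theorem gradAt_eq {m k n : ℕ} (c : ℝ) (A : Matrix (Fin k) (Fin n) ℝ)
    (Wsharp : Matrix (Fin m) (Fin k) ℝ) (t : ℕ) {U : Matrix (Fin k) (Fin k) ℝ}
    (hU : Uᵀ * U = 1) (hU' : U * Uᵀ = 1) {lam : Fin k → ℝ}
    (hB : gram A = U * Matrix.diagonal lam * Uᵀ) :
    gradAt c A Wsharp t = -(Wsharp * U * Matrix.diagonal
      (fun j => lam j * (1 - 1 / (c * opNorm (gram A)) * lam j) ^ t) * Uᵀ) := by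
  rw [gradAt, matGrad_loss, gdIter_loss]
  generalize 1 / (c * opNorm (gram A)) = η
  rw [hB, pow_one_sub_smul_conj hU hU', Matrix.neg_mul]
  congr 1
  calc _ = Wsharp * U * Matrix.diagonal (fun j => (1 - η * lam j) ^ t) * (Uᵀ * U) *
          Matrix.diagonal lam * Uᵀ := by simp only [Matrix.mul_assoc]
    _ = _ := by
      rw [hU, Matrix.mul_one, Matrix.mul_assoc (Wsharp * U), Matrix.diagonal_mul_diagonal]
      simp [mul_comm]

end Gradient

/-! ### Effect of a diagonal filter on Frobenius, fourth Schatten and nuclear norms. -/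

section DiagonalScaling

variable {m k : ℕ} {U : Matrix (Fin k) (Fin k) ℝ} (M : Matrix (Fin m) (Fin k) ℝ)
  (D : Fin k → ℝ)

theorem frobNorm_sq_neg_mul_diagonal (hU : Uᵀ * U = 1) :
    frobNorm (-(M * Matrix.diagonal D * Uᵀ)) ^ 2 = ∑ i, ∑ j, (D j * M i j) ^ 2 := by
  have h : frobNorm (-(M * Matrix.diagonal D * Uᵀ)) ^ 2 =
      frobNorm (M * Matrix.diagonal D) ^ 2 := by
    rw [frobNorm_sq_eq_trace, frobNorm_sq_eq_trace, Matrix.transpose_neg, Matrix.neg_mul,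
      Matrix.mul_neg, neg_neg, Matrix.transpose_mul _ Uᵀ, Matrix.transpose_transpose,
      Matrix.mul_assoc, Matrix.trace_mul_comm, Matrix.mul_assoc, Matrix.mul_assoc, hU,
      Matrix.mul_one]
  rw [h, frobNorm_sq]
  simp [Matrix.mul_diagonal, mul_comm]

theorem frobNorm_gram_conj (X : Matrix (Fin k) (Fin k) ℝ) (hU : Uᵀ * U = 1) :
    frobNorm (U * X * Uᵀ) ^ 2 = frobNorm X ^ 2 := by
  rw [frobNorm_sq_eq_trace, frobNorm_sq_eq_trace, Matrix.transpose_mul, Matrix.transpose_mul,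
    Matrix.transpose_transpose,
    show U * (Xᵀ * Uᵀ) * (U * X * Uᵀ) = U * (Xᵀ * (Uᵀ * U) * X * Uᵀ) by
      simp only [Matrix.mul_assoc], hU, Matrix.mul_one, Matrix.trace_mul_comm, Matrix.mul_assoc,
    Matrix.mul_assoc, hU, Matrix.mul_one]

/-- In the eigenbasis the Gram entry `(i, j)` is merely multiplied by `D i * D j`, so the comparison
is entrywise. -/
theorem frobNorm_gram_neg_mul_diagonal_le (hU : Uᵀ * U = 1) {C : ℝ}
    (hD : ∀ j, |D j| ≤ C) :
    frobNorm ((-(M * Matrix.diagonal D * Uᵀ))ᵀ * (-(M * Matrix.diagonal D * Uᵀ))) ^ 2 ≤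
      C ^ 4 * frobNorm (Mᵀ * M) ^ 2 := by
  have h : (-(M * Matrix.diagonal D * Uᵀ))ᵀ * (-(M * Matrix.diagonal D * Uᵀ)) =
      U * (Matrix.diagonal D * (Mᵀ * M) * Matrix.diagonal D) * Uᵀ := by
    simp only [Matrix.transpose_neg, Matrix.neg_mul, Matrix.mul_neg, neg_neg,
      Matrix.transpose_mul, Matrix.transpose_transpose, Matrix.diagonal_transpose,
      Matrix.mul_assoc]
  rw [h, frobNorm_gram_conj _ hU, frobNorm_sq, frobNorm_sq, Finset.mul_sum]
  refine Finset.sum_le_sum fun i _ => ?_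
  rw [Finset.mul_sum]
  refine Finset.sum_le_sum fun j _ => ?_
  rw [Matrix.mul_diagonal, Matrix.diagonal_mul]
  have h2 : ∀ j, D j ^ 2 ≤ C ^ 2 := fun j =>
    sq_le_sq' (neg_le_of_abs_le (hD j)) (le_of_abs_le (hD j))
  calc (D i * (Mᵀ * M) i j * D j) ^ 2 = D i ^ 2 * D j ^ 2 * (Mᵀ * M) i j ^ 2 := by ring
    _ ≤ C ^ 2 * C ^ 2 * (Mᵀ * M) i j ^ 2 :=
      mul_le_mul_of_nonneg_right (mul_le_mul (h2 i) (h2 j) (sq_nonneg _) (sq_nonneg _))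
        (sq_nonneg _)
    _ = _ := by ring

/-- Cyclicity of the trace removes `U` and turns column inner products into row inner products,
whose Gaussian moments are explicit. -/
theorem frobNorm_gram_mul_orthogonal (W : Matrix (Fin m) (Fin k) ℝ) (hU : U * Uᵀ = 1) :
    frobNorm ((W * U)ᵀ * (W * U)) ^ 2 = ∑ i, ∑ j, (∑ l, W i l * W j l) ^ 2 := by
  have h : frobNorm ((W * U)ᵀ * (W * U)) ^ 2 = frobNorm (W * Wᵀ) ^ 2 := by
    rw [frobNorm_sq_eq_trace, frobNorm_sq_eq_trace]
    simp only [Matrix.transpose_mul, Matrix.transpose_transpose]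
    calc _ = (Uᵀ * (Wᵀ * W * (U * Uᵀ) * Wᵀ * W * U)).trace := by simp only [Matrix.mul_assoc]
      _ = (Wᵀ * W * Wᵀ * W * (U * Uᵀ)).trace := by
        rw [Matrix.trace_mul_comm, hU, Matrix.mul_one]; simp only [Matrix.mul_assoc, hU]
      _ = _ := by
        rw [hU, Matrix.mul_one, Matrix.mul_assoc, Matrix.mul_assoc, Matrix.trace_mul_comm]
        simp only [Matrix.mul_assoc]
  rw [h, frobNorm_sq]
  simp [Matrix.mul_apply]

theorem sum_dite_eq_sum_subtype {ι : Type*} [Fintype ι] (P : ι → Prop) [DecidablePred P]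
    (f : {i // P i} → ℝ) :
    ∑ i, (if h : P i then f ⟨i, h⟩ else 0) = ∑ i, f i := by
  rw [← Fintype.sum_subtype_add_sum_subtype P]
  have h1 : ∑ i : {i // ¬ P i}, (if h : P i then f ⟨i, h⟩ else 0) = 0 :=
    Finset.sum_eq_zero fun i _ => dif_neg i.2
  rw [h1, add_zero]
  exact Finset.sum_congr rfl fun i _ => dif_pos i.2

/-- Let `Y` be dual-optimal for the bulk block. Rescaling its columns by `(D j)⁻¹` and extending by
zero gives a test matrix of operator norm at most `a⁻¹`; the weights cancel in its pairing with the
filtered matrix, which thus equals the nuclear norm of the block. -/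
theorem nucNorm_lastCols_le (hU : Uᵀ * U = 1) (hU' : U * Uᵀ = 1) (r : ℕ) {a : ℝ} (ha : 0 < a)
    (hD : ∀ j : Fin k, r ≤ (j : ℕ) → a ≤ D j) :
    a * nucNorm (lastCols r M) ≤ nucNorm (-(M * Matrix.diagonal D * Uᵀ)) := by
  obtain ⟨Y, hY, htr⟩ := exists_trace_eq_nucNorm (lastCols r M)
  set E : Matrix (Fin m) (Fin k) ℝ :=
    Matrix.of fun i j => if h : r ≤ (j : ℕ) then Y i ⟨j, h⟩ * (D j)⁻¹ else 0 with hE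
  have hEv : ∀ v : Fin k → ℝ, E *ᵥ v = Y *ᵥ (fun j => (D j)⁻¹ * v j) := by
    intro v
    funext i
    simp only [Matrix.mulVec, dotProduct, hE, Matrix.of_apply]
    rw [← sum_dite_eq_sum_subtype (fun j : Fin k => r ≤ (j : ℕ))]
    refine Finset.sum_congr rfl fun j _ => ?_
    split_ifs <;> ring
  have h1 : (((-(M * Matrix.diagonal D * Uᵀ)))ᵀ * (-(E * Uᵀ))).trace = nucNorm (lastCols r M) := by
    rw [← htr]
    rw [Matrix.transpose_neg, Matrix.neg_mul, Matrix.mul_neg, neg_neg, Matrix.transpose_mul _ Uᵀ,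
      Matrix.transpose_transpose, Matrix.mul_assoc, Matrix.trace_mul_comm, Matrix.mul_assoc,
      Matrix.mul_assoc, hU, Matrix.mul_one]
    rw [Matrix.trace, Matrix.trace,
      ← sum_dite_eq_sum_subtype (fun j : Fin k => r ≤ (j : ℕ))]
    refine Finset.sum_congr rfl fun j _ => ?_
    simp only [Matrix.diag_apply, Matrix.mul_apply (M := (M * Matrix.diagonal D)ᵀ),
      Matrix.transpose_apply (M * Matrix.diagonal D), Matrix.mul_diagonal, hE, Matrix.of_apply]
    split_ifs with h
    · have hne : D j ≠ 0 := (ha.trans_le (hD j h)).ne'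
      rw [Matrix.mul_apply]
      refine Finset.sum_congr rfl fun i _ => ?_
      simp only [lastCols, Matrix.transpose_apply, Matrix.submatrix_apply, id]
      field_simp
    · simp
  have h2 : ∀ v : Fin k → ℝ, ((-(E * Uᵀ)) *ᵥ v) ⬝ᵥ ((-(E * Uᵀ)) *ᵥ v) ≤ a⁻¹ ^ 2 * (v ⬝ᵥ v) := by
    intro v
    rw [Matrix.neg_mulVec, neg_dotProduct_neg, ← Matrix.mulVec_mulVec, hEv]
    refine (hY _).trans ?_
    rw [dotProduct_self_eq_sum_of_orthogonal hU' v, Finset.mul_sum, dotProduct,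
      ← sum_dite_eq_sum_subtype (fun j : Fin k => r ≤ (j : ℕ))
        (fun j => (D j)⁻¹ * (Uᵀ *ᵥ v) j * ((D j)⁻¹ * (Uᵀ *ᵥ v) j))]
    refine Finset.sum_le_sum fun j _ => ?_
    split_ifs with h
    · have hinv : (D j)⁻¹ ≤ a⁻¹ := inv_anti₀ ha (hD j h)
      have h0 : 0 ≤ (D j)⁻¹ := inv_nonneg.mpr (ha.le.trans (hD j h))
      calc _ = (D j)⁻¹ ^ 2 * (Uᵀ *ᵥ v) j ^ 2 := by ring
        _ ≤ _ := by gcongr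
    · positivity
  have h3 := trace_transpose_mul_le (-(M * Matrix.diagonal D * Uᵀ)) _ (inv_nonneg.mpr ha.le) h2
  rw [h1, inv_mul_eq_div, le_div_iff₀ ha] at h3
  linarith

end DiagonalScaling

/-! ### Operator norm and eigenvalues. -/

section OperatorNorm

theorem sum_mulVec_sq_le {m k : ℕ} (M : Matrix (Fin m) (Fin k) ℝ) (v : Fin k → ℝ) :
    ∑ i, (M *ᵥ v) i ^ 2 ≤ opNorm M ^ 2 * ∑ j, v j ^ 2 := by
  have h := (Matrix.toEuclideanLin M).toContinuousLinearMap.le_opNorm (WithLp.toLp 2 v)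
  have h2 := pow_le_pow_left₀ (norm_nonneg _) h 2
  rw [mul_pow, EuclideanSpace.real_norm_sq_eq, EuclideanSpace.real_norm_sq_eq] at h2
  simpa [opNorm, Matrix.toLpLin_apply] using h2

theorem opNorm_le {m k : ℕ} (M : Matrix (Fin m) (Fin k) ℝ) {L : ℝ} (hL : 0 ≤ L)
    (h : ∀ v : Fin k → ℝ, ∑ i, (M *ᵥ v) i ^ 2 ≤ L ^ 2 * ∑ j, v j ^ 2) : opNorm M ≤ L := by
  refine ContinuousLinearMap.opNorm_le_bound _ hL fun x => ?_
  refine le_of_sq_le_sq ?_ (by positivity)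
  rw [mul_pow, EuclideanSpace.real_norm_sq_eq, EuclideanSpace.real_norm_sq_eq]
  simpa [Matrix.toLpLin_apply] using h x.ofLp

theorem opNorm_nonneg {m k : ℕ} (M : Matrix (Fin m) (Fin k) ℝ) : 0 ≤ opNorm M := norm_nonneg _

variable {k : ℕ} {U : Matrix (Fin k) (Fin k) ℝ} {lam : Fin k → ℝ}

theorem conj_diagonal_mulVec_col (hU : Uᵀ * U = 1) (j : Fin k) :
    (U * Matrix.diagonal lam * Uᵀ) *ᵥ (U *ᵥ Pi.single j 1) = lam j • (U *ᵥ Pi.single j 1) := by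
  rw [Matrix.mulVec_mulVec, Matrix.mul_assoc, hU, Matrix.mul_one, ← Matrix.mulVec_mulVec,
    ← Matrix.mulVec_smul]
  congr 1
  ext i
  rw [Matrix.mulVec_diagonal]
  by_cases h : i = j
  · subst h; simp
  · simp [h]

theorem sum_col_sq (hU : Uᵀ * U = 1) (j : Fin k) :
    ∑ i, (U *ᵥ Pi.single j 1) i ^ 2 = 1 := by
  have := congrFun (congrFun hU j) j
  rw [Matrix.mul_apply, Matrix.one_apply_eq] at this
  rw [Matrix.mulVec_single_one, ← this]
  exact Finset.sum_congr rfl fun i _ => sq _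

theorem abs_eigenvalue_le_opNorm (hU : Uᵀ * U = 1) (j : Fin k) :
    |lam j| ≤ opNorm (U * Matrix.diagonal lam * Uᵀ) := by
  have h := sum_mulVec_sq_le (U * Matrix.diagonal lam * Uᵀ) (U *ᵥ Pi.single j 1)
  rw [conj_diagonal_mulVec_col hU, sum_col_sq hU] at h
  simp only [Pi.smul_apply, smul_eq_mul, mul_pow] at h
  rw [← Finset.mul_sum, sum_col_sq hU, mul_one, mul_one] at h
  exact abs_le_of_sq_le_sq h (opNorm_nonneg _)

theorem opNorm_conj_diagonal_le (hU : Uᵀ * U = 1) (hU' : U * Uᵀ = 1) {L : ℝ} (hL : 0 ≤ L)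
    (h : ∀ j, |lam j| ≤ L) : opNorm (U * Matrix.diagonal lam * Uᵀ) ≤ L := by
  refine opNorm_le _ hL fun v => ?_
  have e1 : ∀ w : Fin k → ℝ, w ⬝ᵥ w = ∑ i, w i ^ 2 := fun w => by simp [dotProduct, sq]
  rw [← e1, ← e1, dotProduct_self_eq_sum_of_orthogonal hU',
    dotProduct_self_eq_sum_of_orthogonal hU' v, Matrix.mulVec_mulVec, ← Matrix.mul_assoc,
    ← Matrix.mul_assoc, hU, Matrix.one_mul, ← Matrix.mulVec_mulVec, Finset.mul_sum]
  refine Finset.sum_le_sum fun i _ => ?_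
  rw [Matrix.mulVec_diagonal, mul_pow]
  exact mul_le_mul_of_nonneg_right (sq_le_sq' (neg_le_of_abs_le (h i)) (le_of_abs_le (h i)))
    (sq_nonneg _)

theorem sum_col_mul_orthogonal_le {m : ℕ} (W : Matrix (Fin m) (Fin k) ℝ) (hU : Uᵀ * U = 1)
    (j : Fin k) : ∑ i, (W * U) i j ^ 2 ≤ opNorm W ^ 2 := by
  have h := sum_mulVec_sq_le W (U *ᵥ Pi.single j 1)
  rw [sum_col_sq hU, mul_one, Matrix.mulVec_mulVec] at h
  simpa using h

end OperatorNorm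

/-! ### Eigenvalues of a multi-spiked matrix by min-max. -/

section Spectrum

variable {k : ℕ}

theorem exists_eigenbasis {B : Matrix (Fin k) (Fin k) ℝ} (hB : B.IsSymm) :
    ∃ V : Matrix (Fin k) (Fin k) ℝ, Vᵀ * V = 1 ∧
      ∃ s : Fin k → ℝ, (∀ i, s i ∈ spectrum ℝ B) ∧ B = V * Matrix.diagonal s * Vᵀ := by
  have hH : B.IsHermitian := by
    rw [Matrix.IsHermitian, Matrix.conjTranspose_eq_transpose_of_trivial]
    exact hB
  refine ⟨hH.eigenvectorUnitary, ?_, hH.eigenvalues, hH.eigenvalues_mem_spectrum_real, ?_⟩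
  · simpa [Matrix.star_eq_conjTranspose] using Unitary.coe_star_mul_self hH.eigenvectorUnitary
  · have h := hH.spectral_theorem
    rw [Unitary.conjStarAlgAut_apply] at h
    simpa [Matrix.star_eq_conjTranspose] using h

theorem exists_orderedEigenbasis {B : Matrix (Fin k) (Fin k) ℝ} (hB : B.IsSymm) :
    ∃ U, IsOrderedEigenbasis B U := by
  obtain ⟨V, hV, s, -, hs⟩ := exists_eigenbasis hB
  let σ : Equiv.Perm (Fin k) := Tuple.sort (fun i => - s i)
  refine ⟨V.submatrix id σ, ?_, s ∘ σ, ?_, ?_⟩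
  · rw [Matrix.mem_orthogonalGroup_iff', Matrix.transpose_submatrix,
      ← Matrix.submatrix_mul _ _ _ id _ Function.bijective_id, hV, Matrix.submatrix_one_equiv]
  · intro i j hij
    have := Tuple.monotone_sort (fun i => - s i) hij
    simpa using this
  · have h1 : Matrix.diagonal (s ∘ σ) = (Matrix.diagonal s).submatrix σ σ :=
      (Matrix.submatrix_diagonal_equiv s σ).symm
    rw [h1, Matrix.transpose_submatrix, Matrix.submatrix_mul_equiv, Matrix.submatrix_mul_equiv,
      Matrix.submatrix_id_id, ← hs]

/-- Dimension count: the kernel has dimension `k - r`, and only `k - 1 - j < k - r` linear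
conditions are imposed. -/
theorem exists_ker_vector {S U : Matrix (Fin k) (Fin k) ℝ} {r : ℕ} (hr : S.rank = r) (j : Fin k)
    (hj : r ≤ (j : ℕ)) :
    ∃ x : Fin k → ℝ, x ≠ 0 ∧ S *ᵥ x = 0 ∧ ∀ i, j < i → (Uᵀ *ᵥ x) i = 0 := by
  let f : S.mulVecLin.ker →ₗ[ℝ] ({i : Fin k // j < i} → ℝ) :=
    (LinearMap.funLeft ℝ ℝ Subtype.val) ∘ₗ Uᵀ.mulVecLin ∘ₗ S.mulVecLin.ker.subtype
  have hk := S.mulVecLin.finrank_range_add_finrank_ker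
  rw [← Matrix.rank, hr, Module.finrank_fin_fun] at hk
  have hlt : Module.finrank ℝ ({i : Fin k // j < i} → ℝ) <
      Module.finrank ℝ S.mulVecLin.ker := by
    rw [Module.finrank_fintype_fun_eq_card, Fintype.card_subtype]
    have : (Finset.univ.filter fun i => j < i) = Finset.Ioi j := by ext; simp
    rw [this, Fin.card_Ioi]
    omega
  obtain ⟨x, hx, hx0⟩ := Submodule.exists_mem_ne_zero_of_ne_bot
    (LinearMap.ker_ne_bot_of_finrank_lt (f := f) hlt)
  refine ⟨x, fun h => hx0 (Subtype.ext h), x.2, fun i hi => ?_⟩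
  exact congrFun (LinearMap.mem_ker.mp hx) ⟨i, hi⟩

/-- Dimension count: the range has dimension `r`, and only `j < r` linear conditions are imposed. -/
theorem exists_range_vector {S U : Matrix (Fin k) (Fin k) ℝ} {r : ℕ} (hr : S.rank = r)
    (j : Fin k) (hj : (j : ℕ) < r) :
    ∃ y : Fin k → ℝ, S *ᵥ y ≠ 0 ∧ ∀ i, i < j → (Uᵀ *ᵥ (S *ᵥ y)) i = 0 := by
  let f : S.mulVecLin.range →ₗ[ℝ] ({i : Fin k // i < j} → ℝ) :=
    (LinearMap.funLeft ℝ ℝ Subtype.val) ∘ₗ Uᵀ.mulVecLin ∘ₗ S.mulVecLin.range.subtype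
  have hlt : Module.finrank ℝ ({i : Fin k // i < j} → ℝ) <
      Module.finrank ℝ S.mulVecLin.range := by
    rw [← Matrix.rank, hr, Module.finrank_fintype_fun_eq_card, Fintype.card_subtype]
    have : (Finset.univ.filter fun i => i < j) = Finset.Iio j := by ext; simp
    rw [this, Fin.card_Iio]
    exact hj
  obtain ⟨x, hx, hx0⟩ := Submodule.exists_mem_ne_zero_of_ne_bot
    (LinearMap.ker_ne_bot_of_finrank_lt (f := f) hlt)
  obtain ⟨y, hy⟩ := x.2
  have hy' : S *ᵥ y = x := hy
  refine ⟨y, fun h => hx0 (Subtype.ext (hy'.symm.trans h)), fun i hi => ?_⟩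
  rw [hy']
  exact congrFun (LinearMap.mem_ker.mp hx) ⟨i, hi⟩

/-- All three are weighted sums in an eigenbasis of `S`. The lower bound with `a` is restricted to
the range, where components along zero eigenvalues vanish. -/
theorem quadForm_bounds {S : Matrix (Fin k) (Fin k) ℝ} (hS : S.IsSymm) {a b : ℝ} (ha : 0 ≤ a)
    (hb : 0 ≤ b)
    (h : ∀ μ ∈ spectrum ℝ S, μ ≠ 0 → a ≤ μ ∧ μ ≤ b) :
    (∀ v, 0 ≤ v ⬝ᵥ (S *ᵥ v)) ∧ (∀ v, v ⬝ᵥ (S *ᵥ v) ≤ b * (v ⬝ᵥ v)) ∧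
      ∀ y, a * ((S *ᵥ y) ⬝ᵥ (S *ᵥ y)) ≤ (S *ᵥ y) ⬝ᵥ (S *ᵥ (S *ᵥ y)) := by
  obtain ⟨V, hV, s, hs, hSV⟩ := exists_eigenbasis hS
  have hV' : V * Vᵀ = 1 := mul_eq_one_comm.mp hV
  have h0 : ∀ i, 0 ≤ s i ∧ s i ≤ b := fun i => by
    rcases eq_or_ne (s i) 0 with h0 | h0
    · simp [h0, hb]
    · exact ⟨ha.trans (h _ (hs i) h0).1, (h _ (hs i) h0).2⟩
  refine ⟨fun v => ?_, fun v => ?_, fun y => ?_⟩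
  · rw [hSV, dotProduct_mulVec_conj_diagonal]
    exact Finset.sum_nonneg fun i _ => mul_nonneg (h0 i).1 (sq_nonneg _)
  · rw [hSV, dotProduct_mulVec_conj_diagonal, dotProduct_self_eq_sum_of_orthogonal hV',
      Finset.mul_sum]
    exact Finset.sum_le_sum fun i _ => mul_le_mul_of_nonneg_right (h0 i).2 (sq_nonneg _)
  · rw [dotProduct_self_eq_sum_of_orthogonal hV']
    have hVy : ∀ i, (Vᵀ *ᵥ (S *ᵥ y)) i = s i * (Vᵀ *ᵥ y) i := by
      intro i
      rw [hSV, Matrix.mulVec_mulVec, ← Matrix.mul_assoc, ← Matrix.mul_assoc, hV, Matrix.one_mul,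
        ← Matrix.mulVec_mulVec, Matrix.mulVec_diagonal]
    have e : (S *ᵥ y) ⬝ᵥ (S *ᵥ (S *ᵥ y)) = ∑ i, s i * (Vᵀ *ᵥ (S *ᵥ y)) i ^ 2 := by
      conv_lhs => rw [show S *ᵥ (S *ᵥ y) = (V * Matrix.diagonal s * Vᵀ) *ᵥ (S *ᵥ y) by rw [← hSV]]
      rw [dotProduct_mulVec_conj_diagonal]
    rw [e, Finset.mul_sum]
    refine Finset.sum_le_sum fun i _ => ?_
    rw [hVy]
    rcases eq_or_ne (s i) 0 with h0 | h0
    · simp [h0]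
    · exact mul_le_mul_of_nonneg_right (h _ (hs i) h0).1 (sq_nonneg _)

theorem dotProduct_self_pos_of_ne {x : Fin k → ℝ} (hx : x ≠ 0) : 0 < x ⬝ᵥ x :=
  lt_of_le_of_ne (by simpa using dotProduct_star_self_nonneg x)
    fun h => hx (dotProduct_self_eq_zero.mp h.symm)

/-- Location of the ordered eigenvalues of a multi-spiked matrix. -/
theorem MultiSpiked.eigenvalues {c₁ c₂ ℓ u : ℝ} (hc₁ : 0 < c₁) (hc₂ : 0 < c₂) {d r : ℕ}
    {B U : Matrix (Fin k) (Fin k) ℝ} (h : MultiSpiked c₁ c₂ ℓ u d r B)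
    (hU : Uᵀ * U = 1) {lam : Fin k → ℝ} (hlam : Antitone lam)
    (hB : B = U * Matrix.diagonal lam * Uᵀ) (j : Fin k) :
    c₁ ≤ lam j ∧ lam j ≤ c₂ * (d : ℝ) ^ u + c₂ ∧ (r ≤ (j : ℕ) → lam j ≤ c₂) ∧
      ((j : ℕ) < r → c₁ * (d : ℝ) ^ ℓ ≤ lam j) := by
  obtain ⟨S, Sig, hBS, hS, -, hr, hspec, hlo, hhi⟩ := h
  have hU' : U * Uᵀ = 1 := mul_eq_one_comm.mp hU
  obtain ⟨hS0, hS1, hS2⟩ := quadForm_bounds hS (by positivity) (by positivity) hspec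
  have hlo' : ∀ v, c₁ * (v ⬝ᵥ v) ≤ v ⬝ᵥ (Sig *ᵥ v) := fun v => by
    have := hlo.dotProduct_mulVec_nonneg v
    simpa [Matrix.sub_mulVec, dotProduct_sub, Matrix.smul_mulVec] using this
  have hhi' : ∀ v, v ⬝ᵥ (Sig *ᵥ v) ≤ c₂ * (v ⬝ᵥ v) := fun v => by
    have := hhi.dotProduct_mulVec_nonneg v
    simpa [Matrix.sub_mulVec, dotProduct_sub, Matrix.smul_mulVec] using this
  have hq : ∀ v, v ⬝ᵥ (B *ᵥ v) = v ⬝ᵥ (S *ᵥ v) + v ⬝ᵥ (Sig *ᵥ v) := fun v => by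
    rw [hBS, Matrix.add_mulVec, dotProduct_add]
  have hq' : ∀ v, v ⬝ᵥ (B *ᵥ v) = ∑ i, lam i * (Uᵀ *ᵥ v) i ^ 2 := fun v => by
    rw [hB, dotProduct_mulVec_conj_diagonal]
  set x := U *ᵥ Pi.single j (1 : ℝ) with hx
  have hxx : x ⬝ᵥ x = 1 := by
    rw [← sum_col_sq hU j]; simp only [dotProduct, sq, hx]
  have hBx : x ⬝ᵥ (B *ᵥ x) = lam j := by
    rw [hB, hx, conj_diagonal_mulVec_col hU, dotProduct_smul, ← hx, hxx, smul_eq_mul, mul_one]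
  have e1 := hq x
  have e2 := hS0 x
  have e3 := hS1 x
  have e4 := hlo' x
  have e5 := hhi' x
  rw [hxx, mul_one] at e3 e4 e5
  refine ⟨by linarith, by linarith, fun hj => ?_, fun hj => ?_⟩
  -- A vector of `ker S` spanned by the first `j + 1` eigenvectors has Rayleigh quotient at least
  -- `lam j` for `B`, and at most `c₂` since only `Sig` acts on it.
  · obtain ⟨y, hy, hSy, hUy⟩ := exists_ker_vector (U := U) hr j hj
    refine le_of_mul_le_mul_right ?_ (dotProduct_self_pos_of_ne hy)
    refine le_trans ?_ (hhi' y)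
    have := hq y
    rw [hSy, dotProduct_zero, zero_add] at this
    rw [← this, hq', dotProduct_self_eq_sum_of_orthogonal hU' y, Finset.mul_sum]
    refine Finset.sum_le_sum fun i _ => ?_
    rcases lt_or_ge j i with hi | hi
    · simp [hUy i hi]
    · exact mul_le_mul_of_nonneg_right (hlam hi) (sq_nonneg _)
  -- A vector of the range of `S` orthogonal to the first `j` eigenvectors has Rayleigh quotient at
  -- most `lam j` for `B`, and at least that of `S`.
  · obtain ⟨y, hy, hUy⟩ := exists_range_vector (U := U) hr j hj
    have hpos := dotProduct_self_pos_of_ne hy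
    refine le_of_mul_le_mul_right ?_ hpos
    have h1 := hS2 y
    have h2 := hlo' (S *ᵥ y)
    have h3 := hq (S *ᵥ y)
    have h4 : 0 ≤ c₁ * ((S *ᵥ y) ⬝ᵥ (S *ᵥ y)) := by positivity
    have h5 : (S *ᵥ y) ⬝ᵥ (B *ᵥ (S *ᵥ y)) ≤ lam j * ((S *ᵥ y) ⬝ᵥ (S *ᵥ y)) := by
      rw [hq', dotProduct_self_eq_sum_of_orthogonal hU' (S *ᵥ y), Finset.mul_sum]
      refine Finset.sum_le_sum fun i _ => ?_
      rcases lt_or_ge i j with hi | hi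
      · simp [hUy i hi]
      · exact mul_le_mul_of_nonneg_right (hlam hi) (sq_nonneg _)
    linarith

end Spectrum

/-! ### The spectral filter in the time window and its consequences. -/

theorem exp_neg_two_mul_le_one_sub_pow {x : ℝ} (hx0 : 0 ≤ x) (hx : x ≤ 1 / 2) (t : ℕ) :
    Real.exp (-(2 * (x * t))) ≤ (1 - x) ^ t := by
  have h1 : Real.exp (-(2 * x)) ≤ 1 - x := by
    rw [← Real.le_log_iff_exp_le (by linarith)]
    refine le_trans ?_ (Real.one_sub_inv_le_log_of_pos (by linarith))
    have : (1 - x)⁻¹ ≤ 1 + 2 * x := by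
      rw [inv_le_iff_one_le_mul₀ (by linarith)]
      nlinarith
    linarith
  calc Real.exp (-(2 * (x * t))) = Real.exp (-(2 * x)) ^ t := by
        rw [← Real.exp_nat_mul]; ring_nf
    _ ≤ _ := pow_le_pow_left₀ (Real.exp_pos _).le h1 t

/-- In the time window, the spectral filter `lam ↦ lam (1 - η lam) ^ t` is bounded below on the
bulk and bounded above on bulk and spikes. -/
theorem filter_bounds {c₁ c₂ c ℓ u C₂ : ℝ} (hc₁ : 0 < c₁) (hc₁₂ : c₁ ≤ c₂) (hc : 1 ≤ c)
    (hu : 0 < u) {d t : ℕ} (hd : 1 ≤ d) (hd' : c₂ / (c * c₁) / (d : ℝ) ^ u ≤ 1 / 2)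
    (ht : InWindow (2 * c * c₂ * u / c₁) C₂ ℓ u d t) {L lam : ℝ}
    (hL : c₁ * (d : ℝ) ^ u ≤ L) (hL' : L ≤ c₂ * (d : ℝ) ^ u + c₂) (hlam : c₁ ≤ lam)
    (hlamL : lam ≤ L) :
    (lam ≤ c₂ → c₁ * Real.exp (-(2 * (c₂ / (c * c₁) * C₂))) ≤
      lam * (1 - 1 / (c * L) * lam) ^ t) ∧
    (lam ≤ c₂ ∨ c₁ * (d : ℝ) ^ ℓ ≤ lam → |lam * (1 - 1 / (c * L) * lam) ^ t| ≤ 2 * c₂) := by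
  have hc₂ : 0 < c₂ := hc₁.trans_le hc₁₂
  have hc0 : 0 < c := by linarith
  have hd1 : (1 : ℝ) ≤ d := by exact_mod_cast hd
  have hd0 : (0 : ℝ) < d := by linarith
  have hdu : (1 : ℝ) ≤ (d : ℝ) ^ u := Real.one_le_rpow hd1 hu.le
  have hdu0 : (0 : ℝ) < (d : ℝ) ^ u := by linarith
  have hL0 : 0 < L := hc₁.trans_le (hlam.trans hlamL)
  have hlam0 : 0 < lam := hc₁.trans_le hlam
  set x := 1 / (c * L) * lam with hx
  have hx0 : 0 ≤ x := by positivity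
  have hx1 : x ≤ 1 := by
    rw [hx, one_div_mul_eq_div, div_le_one (by positivity)]
    nlinarith
  obtain ⟨ht1, ht2⟩ := ht
  constructor
  · intro h
    have hxu : x ≤ c₂ / (c * c₁) / (d : ℝ) ^ u := by
      rw [hx, one_div_mul_eq_div, div_div]
      have : c * c₁ * (d : ℝ) ^ u ≤ c * L := by
        rw [mul_assoc]; gcongr
      gcongr
    have h1 := exp_neg_two_mul_le_one_sub_pow hx0 (hxu.trans hd') t
    have h2 : x * t ≤ c₂ / (c * c₁) * C₂ := by
      calc x * t ≤ c₂ / (c * c₁) / (d : ℝ) ^ u * (C₂ * (d : ℝ) ^ u) := by gcongr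
        _ = _ := by field_simp
    refine mul_le_mul hlam (le_trans ?_ h1) (Real.exp_pos _).le hlam0.le
    gcongr
  · intro h
    have hp0 : 0 ≤ (1 - x) ^ t := pow_nonneg (by linarith) t
    rw [abs_of_nonneg (by positivity)]
    rcases h with h | h
    · calc lam * (1 - x) ^ t ≤ c₂ * 1 := by
            gcongr
            exact pow_le_one₀ (by linarith) (by linarith)
        _ ≤ 2 * c₂ := by linarith
    -- The additive `c₂` is absorbed because `d ^ u ≥ 1`.
    · have hLle : L ≤ 2 * c₂ * (d : ℝ) ^ u := by nlinarith
      have hxl : c₁ * (d : ℝ) ^ ℓ / (c * (2 * c₂ * (d : ℝ) ^ u)) ≤ x := by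
        rw [hx, one_div_mul_eq_div]
        gcongr
      have hlog : 0 ≤ Real.log d := Real.log_nonneg hd1
      -- The constant `2 * c * c₂ * u / c₁` of the window is chosen to make this product exactly `u
      -- * log d`.
      have hxt : u * Real.log d ≤ x * t := by
        calc u * Real.log d = c₁ * (d : ℝ) ^ ℓ / (c * (2 * c₂ * (d : ℝ) ^ u)) *
              (2 * c * c₂ * u / c₁ * (d : ℝ) ^ (u - ℓ) * Real.log d) := by
              rw [Real.rpow_sub hd0]
              have : (d : ℝ) ^ ℓ ≠ 0 := (Real.rpow_pos_of_pos hd0 _).ne'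
              field_simp
          _ ≤ x * t := mul_le_mul hxl ht1 (by positivity) hx0
      have hp : (1 - x) ^ t ≤ ((d : ℝ) ^ u)⁻¹ := by
        calc (1 - x) ^ t ≤ Real.exp (-x) ^ t :=
              pow_le_pow_left₀ (by linarith) (by linarith [Real.add_one_le_exp (-x)]) t
          _ = Real.exp (-(x * t)) := by rw [← Real.exp_nat_mul]; ring_nf
          _ ≤ Real.exp (-(u * Real.log d)) := by gcongr
          _ = _ := by rw [Real.exp_neg, Real.rpow_def_of_pos hd0, mul_comm]
      calc lam * (1 - x) ^ t ≤ 2 * c₂ * (d : ℝ) ^ u * ((d : ℝ) ^ u)⁻¹ := by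
            gcongr
            exact hlamL.trans hLle
        _ = 2 * c₂ := by field_simp

/-- The gradient along gradient descent in the time window, in the eigenbasis of the Gram
matrix. -/
theorem gradAt_window {c₁ c₂ c ℓ u C₂ : ℝ} (hc₁ : 0 < c₁) (hc₁₂ : c₁ ≤ c₂) (hc : 1 ≤ c)
    (hu : 0 < u) {d : ℕ} (hd : 1 ≤ d) (hd' : c₂ / (c * c₁) / (d : ℝ) ^ u ≤ 1 / 2)
    {m k n r : ℕ} {A : Matrix (Fin k) (Fin n) ℝ} (hA : MultiSpiked c₁ c₂ ℓ u d r (gram A))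
    (hop : c₁ * (d : ℝ) ^ u ≤ opNorm (gram A)) {U : Matrix (Fin k) (Fin k) ℝ}
    (hU : IsOrderedEigenbasis (gram A) U) {t : ℕ}
    (ht : InWindow (2 * c * c₂ * u / c₁) C₂ ℓ u d t) :
    ∃ D : Fin k → ℝ, (∀ j, |D j| ≤ 2 * c₂) ∧
      (∀ j : Fin k, r ≤ (j : ℕ) → c₁ * Real.exp (-(2 * (c₂ / (c * c₁) * C₂))) ≤ D j) ∧
      ∀ W : Matrix (Fin m) (Fin k) ℝ,
        gradAt c A W t = -(W * U * Matrix.diagonal D * Uᵀ) := by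
  obtain ⟨hUo, lam, hlam, hB⟩ := hU
  have hU1 : Uᵀ * U = 1 := (Matrix.mem_orthogonalGroup_iff' _ _).mp hUo
  have hU2 : U * Uᵀ = 1 := (Matrix.mem_orthogonalGroup_iff _ _).mp hUo
  have hc₂ : 0 < c₂ := hc₁.trans_le hc₁₂
  have he := hA.eigenvalues hc₁ hc₂ hU1 hlam hB
  have habs : ∀ j, |lam j| = lam j := fun j => abs_of_pos (hc₁.trans_le (he j).1)
  have hle : ∀ j, lam j ≤ opNorm (gram A) := fun j => by
    have := abs_eigenvalue_le_opNorm (lam := lam) hU1 j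
    rwa [habs, ← hB] at this
  have hub : opNorm (gram A) ≤ c₂ * (d : ℝ) ^ u + c₂ := by
    rw [hB]
    exact opNorm_conj_diagonal_le hU1 hU2 (by positivity) fun j => (habs j).trans_le (he j).2.1
  have hf := fun j => filter_bounds hc₁ hc₁₂ hc hu hd hd' ht hop hub (he j).1 (hle j)
  refine ⟨_, fun j => (hf j).2 ?_, fun j hj => (hf j).1 ((he j).2.2.1 hj),
    fun W => gradAt_eq c A W t hU1 hU2 hB⟩
  rcases le_or_gt r (j : ℕ) with h | h
  · exact Or.inl ((he j).2.2.1 h)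
  · exact Or.inr ((he j).2.2.2 h)

theorem sum_sq_split {m k : ℕ} (r : ℕ) (M : Matrix (Fin m) (Fin k) ℝ) :
    ∑ i, ∑ j, M i j ^ 2 = frobNorm (lastCols r M) ^ 2 +
      ∑ j : {j : Fin k // ¬ r ≤ (j : ℕ)}, ∑ i, M i j ^ 2 := by
  rw [frobNorm_sq, Finset.sum_comm, Finset.sum_comm (s := Finset.univ (α := Fin m))]
  exact (Fintype.sum_subtype_add_sum_subtype (fun j : Fin k => r ≤ (j : ℕ))
    (fun j => ∑ i, M i j ^ 2)).symm

theorem card_first_le (k r : ℕ) : Fintype.card {j : Fin k // ¬ r ≤ (j : ℕ)} ≤ r := by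
  have : Function.Injective (fun j : {j : Fin k // ¬ r ≤ (j : ℕ)} =>
      (⟨(j : Fin k), not_le.mp j.2⟩ : Fin r)) := fun i j h => by
    simpa [Fin.ext_iff, Subtype.ext_iff] using h
  simpa using Fintype.card_le_of_injective _ this

/-- Frobenius bound for the filtered matrix. -/
theorem frobNorm_filtered_le {m k : ℕ} {U : Matrix (Fin k) (Fin k) ℝ} (hU : Uᵀ * U = 1)
    (W : Matrix (Fin m) (Fin k) ℝ) {K C : ℝ} (hC : 0 ≤ C) (hK : opNorm W ≤ K) (r : ℕ)
    {D : Fin k → ℝ} (hD : ∀ j, |D j| ≤ C) :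
    frobNorm (-(W * U * Matrix.diagonal D * Uᵀ)) ≤
      C * (K + 1) * (frobNorm (lastCols r (W * U)) + √(r : ℝ)) := by
  have hK0 : 0 ≤ K := (opNorm_nonneg W).trans hK
  set F := frobNorm (lastCols r (W * U)) with hF
  have hF0 : 0 ≤ F := frobNorm_nonneg _
  have h1 : frobNorm (-(W * U * Matrix.diagonal D * Uᵀ)) ^ 2 ≤ C ^ 2 * (F ^ 2 + r * K ^ 2) := by
    rw [frobNorm_sq_neg_mul_diagonal _ _ hU]
    calc ∑ i, ∑ j, (D j * (W * U) i j) ^ 2 ≤ ∑ i, ∑ j, C ^ 2 * (W * U) i j ^ 2 := by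
          refine Finset.sum_le_sum fun i _ => Finset.sum_le_sum fun j _ => ?_
          rw [mul_pow]
          exact mul_le_mul_of_nonneg_right
            (sq_le_sq' (neg_le_of_abs_le (hD j)) (le_of_abs_le (hD j))) (sq_nonneg _)
      _ = C ^ 2 * ∑ i, ∑ j, (W * U) i j ^ 2 := by simp only [Finset.mul_sum]
      _ ≤ _ := by
          rw [sum_sq_split r]
          gcongr
          calc ∑ j : {j : Fin k // ¬ r ≤ (j : ℕ)}, ∑ i, (W * U) i j ^ 2
              ≤ ∑ _j : {j : Fin k // ¬ r ≤ (j : ℕ)}, K ^ 2 :=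
                Finset.sum_le_sum fun j _ => (sum_col_mul_orthogonal_le W hU j).trans
                  (pow_le_pow_left₀ (opNorm_nonneg W) hK 2)
            _ = Fintype.card {j : Fin k // ¬ r ≤ (j : ℕ)} * K ^ 2 := by simp
            _ ≤ r * K ^ 2 := by
                gcongr
                exact card_first_le k r
  refine le_of_sq_le_sq (h1.trans ?_) (by positivity)
  have hr : √(r : ℝ) ^ 2 = r := Real.sq_sqrt (Nat.cast_nonneg r)
  rw [mul_pow, mul_pow, mul_assoc]
  gcongr
  have hs := Real.sqrt_nonneg (r : ℝ)
  -- The factor `K + 1` dominates both `1`, needed for the bulk, and `K`, needed for the spikes.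
  calc F ^ 2 + r * K ^ 2 ≤ (K + 1) ^ 2 * F ^ 2 + (K + 1) ^ 2 * √(r : ℝ) ^ 2 := by
        rw [hr]
        have : 1 ≤ (K + 1) ^ 2 := by nlinarith
        have h3 : K ^ 2 ≤ (K + 1) ^ 2 := by nlinarith
        have h4 : (0 : ℝ) ≤ r := Nat.cast_nonneg r
        nlinarith [mul_le_mul_of_nonneg_left h3 h4, mul_le_mul_of_nonneg_right this (sq_nonneg F)]
    _ ≤ _ := by nlinarith [mul_nonneg hF0 hs, mul_nonneg (mul_nonneg hF0 hs) (sq_nonneg (K + 1))]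

/-- Nuclear rank bound for the filtered matrix. -/
theorem nuclearRank_filtered_ge {m k : ℕ} {U : Matrix (Fin k) (Fin k) ℝ} (hU : Uᵀ * U = 1)
    (W : Matrix (Fin m) (Fin k) ℝ) {a C x y : ℝ} (ha : 0 < a) (r : ℕ) {D : Fin k → ℝ}
    (hD : ∀ j, |D j| ≤ C) (hD' : ∀ j : Fin k, r ≤ (j : ℕ) → a ≤ D j) (hx : 0 < x)
    (hF : x ≤ frobNorm (lastCols r (W * U)) ^ 2)
    (hQ : ∑ i, ∑ j, (∑ l, W i l * W j l) ^ 2 ≤ y) :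
    (a ^ 2 * x) ^ 2 / (C ^ 4 * y) ≤ nuclearRank (-(W * U * Matrix.diagonal D * Uᵀ)) := by
  have hU' : U * Uᵀ = 1 := mul_eq_one_comm.mp hU
  refine nuclearRank_ge _ (by positivity) ?_ ?_
  · rw [frobNorm_sq_neg_mul_diagonal _ _ hU]
    calc a ^ 2 * x ≤ a ^ 2 * frobNorm (lastCols r (W * U)) ^ 2 := by gcongr
      _ ≤ frobNorm (lastCols r (Matrix.of fun i j => D j * (W * U) i j)) ^ 2 := by
          rw [frobNorm_sq, frobNorm_sq]
          simp only [Finset.mul_sum]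
          refine Finset.sum_le_sum fun i _ => Finset.sum_le_sum fun j _ => ?_
          simp only [lastCols, Matrix.submatrix_apply, id, Matrix.of_apply, mul_pow]
          have := hD' j j.2
          gcongr
      _ ≤ _ := by
          have := sum_sq_split r (Matrix.of fun i j => D j * (W * U) i j)
          simp only [Matrix.of_apply] at this
          rw [this]
          exact le_add_of_nonneg_right
            (Finset.sum_nonneg fun j _ => Finset.sum_nonneg fun i _ => sq_nonneg _)
  · refine (frobNorm_gram_neg_mul_diagonal_le _ _ hU hD).trans ?_
    rw [frobNorm_gram_mul_orthogonal W hU']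
    exact mul_le_mul_of_nonneg_left hQ (by positivity)

/-! ### Moments of independent sums, Chebyshev and Markov. -/

section Moments

variable {Ω : Type*} [MeasurableSpace Ω] {P : Measure Ω}

/-- All absolute moments of `X` are finite. -/
def HasMoments (P : Measure Ω) (X : Ω → ℝ) : Prop :=
  ∀ p : ENNReal, p ≠ ⊤ → MemLp X p P

namespace HasMoments

variable {X Y : Ω → ℝ}

theorem add (hX : HasMoments P X) (hY : HasMoments P Y) :
    HasMoments P (fun ω => X ω + Y ω) := fun p hp => (hX p hp).add (hY p hp)

theorem const [IsProbabilityMeasure P] (a : ℝ) : HasMoments P (fun _ => a) :=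
  fun _ _ => memLp_const a

/-- Hölder with exponents `2p, 2p`: requiring all finite moments makes the class stable under
products. -/
theorem mul (hX : HasMoments P X) (hY : HasMoments P Y) :
    HasMoments P (fun ω => X ω * Y ω) := fun p hp => by
  have hp2 : (2 * p : ENNReal) ≠ ⊤ := ENNReal.mul_ne_top (by simp) hp
  have : ENNReal.HolderTriple (2 * p) (2 * p) p := ⟨by
    rw [ENNReal.mul_inv (by simp) (by simp), ← add_mul, ENNReal.inv_two_add_inv_two, one_mul]⟩
  exact (hY (2 * p) hp2).mul (hX (2 * p) hp2)

theorem pow [IsProbabilityMeasure P] (hX : HasMoments P X) (n : ℕ) :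
    HasMoments P (fun ω => X ω ^ n) := by
  induction n with
  | zero => simpa using const (P := P) 1
  | succ n ih => simpa only [pow_succ] using ih.mul hX

theorem const_mul [IsProbabilityMeasure P] (hX : HasMoments P X) (a : ℝ) :
    HasMoments P (fun ω => a * X ω) := (const a).mul hX

theorem sub_const [IsProbabilityMeasure P] (hX : HasMoments P X) (a : ℝ) :
    HasMoments P (fun ω => X ω - a) := by
  simpa only [sub_eq_add_neg] using hX.add (const (-a))

theorem sum [IsProbabilityMeasure P] {ι : Type*} (s : Finset ι) {X : ι → Ω → ℝ}
    (hX : ∀ i ∈ s, HasMoments P (X i)) : HasMoments P (fun ω => ∑ i ∈ s, X i ω) :=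
  fun p hp => memLp_finsetSum s fun i hi => hX i hi p hp

theorem integrable [IsProbabilityMeasure P] (hX : HasMoments P X) : Integrable X P :=
  (hX 1 (by simp)).integrable le_rfl

theorem memLp_two (hX : HasMoments P X) : MemLp X 2 P := hX 2 (by simp)

end HasMoments

variable [IsProbabilityMeasure P]

theorem integral_add_sq_of_indep {X Y : Ω → ℝ} (hX : HasMoments P X) (hY : HasMoments P Y)
    (h : IndepFun X Y P) (hY0 : ∫ ω, Y ω ∂P = 0) :
    ∫ ω, (X ω + Y ω) ^ 2 ∂P = ∫ ω, X ω ^ 2 ∂P + ∫ ω, Y ω ^ 2 ∂P := by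
  have e : ∀ ω, (X ω + Y ω) ^ 2 = X ω ^ 2 + 2 * (X ω * Y ω) + Y ω ^ 2 := fun ω => by ring
  have h1 := hX.pow 2
  have h2 := (hX.mul hY).const_mul 2
  have h3 := hY.pow 2
  have hXY : ∫ ω, X ω * Y ω ∂P = 0 := by
    rw [h.integral_fun_mul_eq_mul_integral hX.integrable.aestronglyMeasurable
      hY.integrable.aestronglyMeasurable, hY0, mul_zero]
  simp_rw [e]
  rw [integral_add (h1.add h2).integrable h3.integrable, integral_add h1.integrable h2.integrable,
    integral_const_mul, hXY]
  ring

theorem integral_add_pow_four_of_indep {X Y : Ω → ℝ} (hX : HasMoments P X)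
    (hY : HasMoments P Y) (h : IndepFun X Y P) (hX0 : ∫ ω, X ω ∂P = 0)
    (hY0 : ∫ ω, Y ω ∂P = 0) :
    ∫ ω, (X ω + Y ω) ^ 4 ∂P = ∫ ω, X ω ^ 4 ∂P +
      6 * ((∫ ω, X ω ^ 2 ∂P) * ∫ ω, Y ω ^ 2 ∂P) + ∫ ω, Y ω ^ 4 ∂P := by
  have e : ∀ ω, (X ω + Y ω) ^ 4 = X ω ^ 4 + 4 * (X ω ^ 3 * Y ω) + 6 * (X ω ^ 2 * Y ω ^ 2) +
      4 * (X ω * Y ω ^ 3) + Y ω ^ 4 := fun ω => by ring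
  have key : ∀ a b : ℕ, ∫ ω, X ω ^ a * Y ω ^ b ∂P = (∫ ω, X ω ^ a ∂P) * ∫ ω, Y ω ^ b ∂P :=
    fun a b => (h.comp (measurable_id.pow_const a) (measurable_id.pow_const b)
      ).integral_fun_mul_eq_mul_integral (hX.pow a).integrable.aestronglyMeasurable
        (hY.pow b).integrable.aestronglyMeasurable
  have k1 : ∫ ω, X ω ^ 3 * Y ω ∂P = 0 := by simpa [hY0] using key 3 1
  have k2 : ∫ ω, X ω * Y ω ^ 3 ∂P = 0 := by simpa [hX0] using key 1 3
  have i1 := hX.pow 4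
  have i2 := ((hX.pow 3).mul hY).const_mul 4
  have i3 := ((hX.pow 2).mul (hY.pow 2)).const_mul 6
  have i4 := (hX.mul (hY.pow 3)).const_mul 4
  have i5 := hY.pow 4
  simp_rw [e]
  rw [integral_add (((i1.add i2).add i3).add i4).integrable i5.integrable,
    integral_add ((i1.add i2).add i3).integrable i4.integrable,
    integral_add (i1.add i2).integrable i3.integrable,
    integral_add i1.integrable i2.integrable, integral_const_mul, integral_const_mul,
    integral_const_mul, k1, k2, key 2 2]
  ring

theorem variance_le_integral_sq {X : Ω → ℝ} (hX : HasMoments P X) :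
    variance X P ≤ ∫ ω, X ω ^ 2 ∂P := by
  simpa using variance_le_expectation_sq hX.integrable.aestronglyMeasurable

theorem prob_abs_sub_ge_le {X : Ω → ℝ} (hX : HasMoments P X) {V δ : ℝ} (hV : variance X P ≤ V)
    (hδ : 0 < δ) : P.real {ω | δ ≤ |X ω - ∫ x, X x ∂P|} ≤ V / δ ^ 2 := by
  have h := meas_ge_le_variance_div_sq hX.memLp_two hδ
  have h0 : 0 ≤ variance X P / δ ^ 2 := div_nonneg (variance_nonneg X P) (sq_nonneg _)
  refine (ENNReal.toReal_le_of_le_ofReal h0 h).trans ?_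
  gcongr

theorem prob_ge_le {X : Ω → ℝ} (hX : HasMoments P X) (hX0 : ∀ ω, 0 ≤ X ω) {E δ : ℝ}
    (hE : ∫ x, X x ∂P ≤ E) (hδ : 0 < δ) : P.real {ω | δ ≤ X ω} ≤ E / δ := by
  have h := mul_meas_ge_le_integral_of_nonneg (Eventually.of_forall hX0) hX.integrable δ
  rw [le_div_iff₀ hδ, mul_comm]
  exact h.trans hE

end Moments

/-- The fourth moment of the standard Gaussian law. -/
def gaussFourth : ℝ := ∫ x, x ^ 4 ∂(gaussianReal 0 1)

/-! ### Moments of Gaussian entries and of inner products of rows. -/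

section Gaussian

theorem gaussFourth_nonneg : 0 ≤ gaussFourth := integral_nonneg fun x => by positivity

variable {Ω : Type*} [MeasurableSpace Ω] {P : Measure Ω} {m k : ℕ}
  {v : ℝ≥0} {W : Ω → Matrix (Fin m) (Fin k) ℝ}

theorem integral_pow_four_gaussianReal (v : ℝ≥0) :
    ∫ x, x ^ 4 ∂(gaussianReal 0 v) = gaussFourth * (v : ℝ) ^ 2 := by
  have h : gaussianReal 0 v = (gaussianReal 0 1).map (fun x => √(v : ℝ) * x) := by
    rw [gaussianReal_map_const_mul]
    congr 1
    · simp
    · ext; simp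
  rw [h, integral_map (by fun_prop) (by fun_prop), gaussFourth, ← integral_mul_const]
  refine integral_congr_ae (Eventually.of_forall fun x => ?_)
  have := Real.sq_sqrt v.coe_nonneg
  simp only [mul_pow]
  rw [show √(v : ℝ) ^ 4 = (√(v : ℝ) ^ 2) ^ 2 by ring, this]
  ring

namespace IsGaussianMatrix

theorem hasMoments (hW : IsGaussianMatrix P v W) (i : Fin m) (j : Fin k) :
    HasMoments P (fun ω => W ω i j) := fun p hp => by
  have h := (hW.1 i j)
  have := memLp_id_gaussianReal' (μ := 0) (v := v) p hp
  rw [← h.map_eq] at this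
  exact (memLp_map_measure_iff aestronglyMeasurable_id h.aemeasurable).mp this

theorem integral_comp (hW : IsGaussianMatrix P v W) (i : Fin m) (j : Fin k) {f : ℝ → ℝ}
    (hf : Measurable f) : ∫ ω, f (W ω i j) ∂P = ∫ x, f x ∂(gaussianReal 0 v) := by
  rw [← (hW.1 i j).map_eq, integral_map (hW.1 i j).aemeasurable hf.aestronglyMeasurable]

theorem integral_eq (hW : IsGaussianMatrix P v W) (i : Fin m) (j : Fin k) :
    ∫ ω, W ω i j ∂P = 0 := by
  simpa using hW.integral_comp i j measurable_id

theorem integral_sq (hW : IsGaussianMatrix P v W) (i : Fin m) (j : Fin k) :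
    ∫ ω, W ω i j ^ 2 ∂P = v := by
  rw [hW.integral_comp i j (f := fun x => x ^ 2) (by fun_prop)]
  have h := variance_fun_id_gaussianReal (μ := 0) (v := v)
  rwa [variance_of_integral_eq_zero (by fun_prop) (by simp)] at h

theorem integral_pow_four (hW : IsGaussianMatrix P v W) (i : Fin m) (j : Fin k) :
    ∫ ω, W ω i j ^ 4 ∂P = gaussFourth * (v : ℝ) ^ 2 := by
  rw [hW.integral_comp i j (f := fun x => x ^ 4) (by fun_prop), integral_pow_four_gaussianReal]

/-- Measurable functions of disjoint sets of entries are independent. -/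
theorem indepFun (hW : IsGaussianMatrix P v W) {S T : Finset (Fin m × Fin k)}
    (hST : Disjoint S T) {f g : (Fin m × Fin k → ℝ) → ℝ} (hf : Measurable f) (hg : Measurable g)
    (hfS : ∀ x y, (∀ p ∈ S, x p = y p) → f x = f y)
    (hgT : ∀ x y, (∀ p ∈ T, x p = y p) → g x = g y) :
    IndepFun (fun ω => f fun p => W ω p.1 p.2) (fun ω => g fun p => W ω p.1 p.2) P := by
  classical
  have h := hW.2.indepFun_finset₀ S T hST (fun p => (hW.1 p.1 p.2).aemeasurable)
  -- Extension by zero lets `f` and `g` be evaluated from their own entries alone.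
  let ext : ∀ R : Finset (Fin m × Fin k), (R → ℝ) → (Fin m × Fin k → ℝ) :=
    fun R x p => if hp : p ∈ R then x ⟨p, hp⟩ else 0
  have hext : ∀ R, Measurable (ext R) := fun R => by
    refine measurable_pi_lambda _ fun p => ?_
    by_cases hp : p ∈ R
    · simpa [ext, hp] using measurable_pi_apply _
    · simp [ext, hp]
  convert h.comp (hf.comp (hext S)) (hg.comp (hext T)) using 1
  · funext ω
    exact hfS _ _ fun p hp => by simp [ext, hp]
  · funext ω
    exact hgT _ _ fun p hp => by simp [ext, hp]

theorem indepFun_entries (hW : IsGaussianMatrix P v W) {p q : Fin m × Fin k} (h : p ≠ q) :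
    IndepFun (fun ω => W ω p.1 p.2) (fun ω => W ω q.1 q.2) P := hW.2.indepFun h

variable [IsProbabilityMeasure P]

/-- Mean and variance of a sum of squared entries. -/
theorem sum_sq (hW : IsGaussianMatrix P v W) (s : Finset (Fin m × Fin k)) :
    ∫ ω, ∑ p ∈ s, W ω p.1 p.2 ^ 2 ∂P = s.card * v ∧
      variance (fun ω => ∑ p ∈ s, W ω p.1 p.2 ^ 2) P ≤
        s.card * (gaussFourth * (v : ℝ) ^ 2) := by
  have hm := fun p : Fin m × Fin k => (hW.hasMoments p.1 p.2).pow 2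
  constructor
  · rw [integral_finsetSum _ fun p _ => (hm p).integrable]
    simp [hW.integral_sq]
  · have h := IndepFun.variance_sum (s := s) (X := fun p ω => W ω p.1 p.2 ^ 2) (μ := P)
      (fun p _ => (hm p).memLp_two) (fun p _ q _ hpq => (hW.indepFun_entries hpq).comp
        (measurable_id.pow_const 2) (measurable_id.pow_const 2))
    have e : (fun ω => ∑ p ∈ s, W ω p.1 p.2 ^ 2) = ∑ p ∈ s, fun ω => W ω p.1 p.2 ^ 2 := by
      funext ω; simp
    rw [e, h, ← nsmul_eq_mul]
    refine Finset.sum_le_card_nsmul _ _ _ fun p _ => ?_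
    refine (variance_le_integral_sq (hm p)).trans (le_of_eq ?_)
    rw [← hW.integral_pow_four p.1 p.2]
    simp only [← pow_mul]

/-- Second moment of a linear form in the entries of a row. -/
theorem integral_row_sq (hW : IsGaussianMatrix P v W) (i : Fin m) (a : Fin k → ℝ) :
    ∫ ω, (∑ l, W ω i l * a l) ^ 2 ∂P = v * ∑ l, a l ^ 2 := by
  have key : ∀ s : Finset (Fin k), ∫ ω, (∑ l ∈ s, W ω i l * a l) ^ 2 ∂P =
      v * ∑ l ∈ s, a l ^ 2 := by
    classical
    intro s
    have hm : ∀ l, HasMoments P (fun ω => W ω i l * a l) :=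
      fun l => (hW.hasMoments i l).mul (HasMoments.const _)
    induction s using Finset.induction_on with
    | empty => simp
    | insert l s hl ih =>
      simp_rw [Finset.sum_insert hl]
      have hind : IndepFun (fun ω => W ω i l * a l) (fun ω => ∑ l ∈ s, W ω i l * a l) P :=
        hW.indepFun (S := {(i, l)}) (T := s.map ⟨fun l => (i, l), Prod.mk_right_injective i⟩)
          (f := fun x => x (i, l) * a l) (g := fun x => ∑ l ∈ s, x (i, l) * a l)
          (by simp [hl]) (by fun_prop) (by fun_prop)
          (fun x y h => by simp [h (i, l) (by simp)])
          (fun x y h => Finset.sum_congr rfl fun l hl => by rw [h (i, l) (by simp [hl])])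
      rw [integral_add_sq_of_indep (hm l) (HasMoments.sum s fun l _ => hm l) hind, ih, mul_add]
      · congr 1
        simp_rw [mul_pow]
        rw [integral_mul_const, hW.integral_sq]
      · rw [integral_finsetSum _ fun l _ => (hm l).integrable]
        refine Finset.sum_eq_zero fun l _ => ?_
        rw [integral_mul_const, hW.integral_eq, zero_mul]
  exact key Finset.univ

/-- Moments of the inner product of two distinct rows. -/
theorem rows_inner (hW : IsGaussianMatrix P v W) {i j : Fin m} (hij : i ≠ j)
    (s : Finset (Fin k)) :
    ∫ ω, ∑ l ∈ s, W ω i l * W ω j l ∂P = 0 ∧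
    ∫ ω, (∑ l ∈ s, W ω i l * W ω j l) ^ 2 ∂P = s.card * (v : ℝ) ^ 2 ∧
    ∫ ω, (∑ l ∈ s, W ω i l * W ω j l) ^ 4 ∂P ≤
      (s.card * gaussFourth ^ 2 + 3 * (s.card : ℝ) ^ 2) * (v : ℝ) ^ 4 := by
  classical
  have hm : ∀ l, HasMoments P (fun ω => W ω i l * W ω j l) :=
    fun l => (hW.hasMoments i l).mul (hW.hasMoments j l)
  have hpow : ∀ (l : Fin k) (n : ℕ), ∫ ω, (W ω i l * W ω j l) ^ n ∂P =
      (∫ ω, W ω i l ^ n ∂P) * ∫ ω, W ω j l ^ n ∂P := by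
    intro l n
    simp_rw [mul_pow]
    exact ((hW.indepFun_entries (p := (i, l)) (q := (j, l)) (by simp [hij])).comp
      (measurable_id.pow_const n) (measurable_id.pow_const n)).integral_fun_mul_eq_mul_integral
      ((hW.hasMoments i l).pow n).integrable.aestronglyMeasurable
      ((hW.hasMoments j l).pow n).integrable.aestronglyMeasurable
  have h1 : ∀ l, ∫ ω, W ω i l * W ω j l ∂P = 0 := fun l => by
    simpa [hW.integral_eq] using hpow l 1
  have h2 : ∀ l, ∫ ω, (W ω i l * W ω j l) ^ 2 ∂P = (v : ℝ) ^ 2 := fun l => by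
    rw [hpow, hW.integral_sq, hW.integral_sq, sq]
  have h4 : ∀ l, ∫ ω, (W ω i l * W ω j l) ^ 4 ∂P = gaussFourth ^ 2 * (v : ℝ) ^ 4 := fun l => by
    rw [hpow, hW.integral_pow_four, hW.integral_pow_four]; ring
  induction s using Finset.induction_on with
  | empty => simp
  | insert l s hl ih =>
    obtain ⟨ih1, ih2, ih4⟩ := ih
    simp_rw [Finset.sum_insert hl, Finset.card_insert_of_notMem hl]
    have hs := HasMoments.sum s fun l _ => hm l
    have hind : IndepFun (fun ω => W ω i l * W ω j l)
        (fun ω => ∑ l ∈ s, W ω i l * W ω j l) P :=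
      hW.indepFun (S := Finset.univ ×ˢ {l}) (T := Finset.univ ×ˢ s)
        (f := fun x => x (i, l) * x (j, l)) (g := fun x => ∑ l ∈ s, x (i, l) * x (j, l))
        (Finset.disjoint_product.mpr (Or.inr (by simpa using hl))) (by fun_prop) (by fun_prop)
        (fun x y h => by rw [h (i, l) (by simp), h (j, l) (by simp)])
        (fun x y h => Finset.sum_congr rfl fun l hl => by
          rw [h (i, l) (by simp [hl]), h (j, l) (by simp [hl])])
    refine ⟨?_, ?_, ?_⟩
    · rw [integral_add (hm l).integrable hs.integrable, h1, ih1, add_zero]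
    · rw [integral_add_sq_of_indep (hm l) hs hind ih1, h2, ih2]
      push_cast; ring
    -- With `n = s.card`, the cross term contributes `6 n v⁴`, which is covered by the increment `6
    -- n + 3` of `3 n²`.
    · rw [integral_add_pow_four_of_indep (hm l) hs hind (h1 l) ih1, h2, h4, ih2]
      push_cast
      have : 0 ≤ (v : ℝ) ^ 4 := by positivity
      nlinarith

end IsGaussianMatrix

end Gaussian

/-! ### Concentration of the two Gaussian quantities. -/

section Concentration

variable {Ω : Type*} [MeasurableSpace Ω] {P : Measure Ω} [IsProbabilityMeasure P] {m k : ℕ}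
  {v : ℝ≥0} {W : Ω → Matrix (Fin m) (Fin k) ℝ}

namespace IsGaussianMatrix

theorem hasMoments_inner_sq (hW : IsGaussianMatrix P v W) (p : Fin m × Fin m) :
    HasMoments P (fun ω => (∑ l, W ω p.1 l * W ω p.2 l) ^ 2) :=
  (HasMoments.sum _ fun l _ => (hW.hasMoments p.1 l).mul (hW.hasMoments p.2 l)).pow 2

/-- Squared inner products of disjoint pairs of rows are uncorrelated. -/
theorem covariance_inner_sq_eq_zero (hW : IsGaussianMatrix P v W) {p q : Fin m × Fin m}
    (h : q.1 ≠ p.1 ∧ q.1 ≠ p.2 ∧ q.2 ≠ p.1 ∧ q.2 ≠ p.2) :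
    covariance (fun ω => (∑ l, W ω p.1 l * W ω p.2 l) ^ 2)
      (fun ω => (∑ l, W ω q.1 l * W ω q.2 l) ^ 2) P = 0 := by
  classical
  obtain ⟨h1, h2, h3, h4⟩ := h
  refine IndepFun.covariance_eq_zero ?_ (hW.hasMoments_inner_sq p).memLp_two
    (hW.hasMoments_inner_sq q).memLp_two
  refine hW.indepFun (S := {p.1, p.2} ×ˢ Finset.univ) (T := {q.1, q.2} ×ˢ Finset.univ)
    (f := fun x => (∑ l, x (p.1, l) * x (p.2, l)) ^ 2)
    (g := fun x => (∑ l, x (q.1, l) * x (q.2, l)) ^ 2)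
    (Finset.disjoint_product.mpr (Or.inl ?_)) (by fun_prop) (by fun_prop) ?_ ?_
  · simp [h1, h2, h3, h4]
  · intro x y h
    congr 1
    exact Finset.sum_congr rfl fun l _ => by rw [h (p.1, l) (by simp), h (p.2, l) (by simp)]
  · intro x y h
    congr 1
    exact Finset.sum_congr rfl fun l _ => by rw [h (q.1, l) (by simp), h (q.2, l) (by simp)]

/-- The product of the means is nonnegative and may be dropped; the mixed moment is at most the
average of the two fourth moments. -/
theorem covariance_inner_sq_le (hW : IsGaussianMatrix P v W) {p q : Fin m × Fin m}
    (hp : p.1 ≠ p.2) (hq : q.1 ≠ q.2) :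
    covariance (fun ω => (∑ l, W ω p.1 l * W ω p.2 l) ^ 2)
      (fun ω => (∑ l, W ω q.1 l * W ω q.2 l) ^ 2) P ≤
      (k * gaussFourth ^ 2 + 3 * (k : ℝ) ^ 2) * (v : ℝ) ^ 4 := by
  have hmp := hW.hasMoments_inner_sq p
  have hmq := hW.hasMoments_inner_sq q
  rw [covariance_eq_sub hmp.memLp_two hmq.memLp_two]
  have h0 : 0 ≤ (∫ ω, (∑ l, W ω p.1 l * W ω p.2 l) ^ 2 ∂P) *
      ∫ ω, (∑ l, W ω q.1 l * W ω q.2 l) ^ 2 ∂P :=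
    mul_nonneg (integral_nonneg fun _ => sq_nonneg _) (integral_nonneg fun _ => sq_nonneg _)
  have hp4 := (hW.rows_inner hp Finset.univ).2.2
  have hq4 := (hW.rows_inner hq Finset.univ).2.2
  rw [Finset.card_univ, Fintype.card_fin] at hp4 hq4
  have hmp4 : HasMoments P (fun ω => (∑ l, W ω p.1 l * W ω p.2 l) ^ 4) := by
    simpa only [← pow_mul] using hmp.pow 2
  have hmq4 : HasMoments P (fun ω => (∑ l, W ω q.1 l * W ω q.2 l) ^ 4) := by
    simpa only [← pow_mul] using hmq.pow 2
  have h1 : ∫ ω, (∑ l, W ω p.1 l * W ω p.2 l) ^ 2 * (∑ l, W ω q.1 l * W ω q.2 l) ^ 2 ∂P ≤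
      ∫ ω, 2⁻¹ * ((∑ l, W ω p.1 l * W ω p.2 l) ^ 4 + (∑ l, W ω q.1 l * W ω q.2 l) ^ 4) ∂P := by
    refine integral_mono (hmp.mul hmq).integrable ((hmp4.add hmq4).const_mul _).integrable
      fun ω => ?_
    have := two_mul_le_add_sq ((∑ l, W ω p.1 l * W ω p.2 l) ^ 2)
      ((∑ l, W ω q.1 l * W ω q.2 l) ^ 2)
    simp only
    nlinarith
  rw [integral_const_mul, integral_add hmp4.integrable hmq4.integrable] at h1
  simp only [Pi.mul_apply]
  linarith

/-- Only pairs of pairs sharing a row are correlated, which gives `m³` rather than `m⁴` terms. For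
`v = 1/d` and `m, k` of order `d` the variance is `O(d)`, so Chebyshev works at deviation `d`. -/
theorem variance_offDiag_le (hW : IsGaussianMatrix P v W) :
    variance (fun ω => ∑ p ∈ (Finset.univ : Finset (Fin m)).offDiag,
      (∑ l, W ω p.1 l * W ω p.2 l) ^ 2) P ≤
      4 * (m : ℝ) ^ 3 * ((k * gaussFourth ^ 2 + 3 * (k : ℝ) ^ 2) * (v : ℝ) ^ 4) := by
  classical
  set β := (k * gaussFourth ^ 2 + 3 * (k : ℝ) ^ 2) * (v : ℝ) ^ 4 with hβ
  have hβ0 : 0 ≤ β := by positivity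
  have e : (fun ω => ∑ p ∈ (Finset.univ : Finset (Fin m)).offDiag,
      (∑ l, W ω p.1 l * W ω p.2 l) ^ 2) = ∑ p ∈ (Finset.univ : Finset (Fin m)).offDiag,
      fun ω => (∑ l, W ω p.1 l * W ω p.2 l) ^ 2 := by funext ω; simp
  rw [e, variance_sum' fun p _ => (hW.hasMoments_inner_sq p).memLp_two]
  -- A majorant of the covariance that counts coincidences of indices; its row sums are explicit.
  let g : Fin m × Fin m → Fin m × Fin m → ℝ := fun p q =>
    β * ((if q.1 = p.1 then 1 else 0) + (if q.1 = p.2 then 1 else 0) +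
      (if q.2 = p.1 then 1 else 0) + (if q.2 = p.2 then 1 else 0))
  have hg0 : ∀ p q, 0 ≤ g p q := fun p q => by simp only [g]; positivity
  have hg : ∀ p, ∑ q, g p q = 4 * m * β := by
    intro p
    have h1 : ∀ a : Fin m, ∑ q : Fin m × Fin m, (if q.1 = a then (1 : ℝ) else 0) = m :=
      fun a => by rw [Fintype.sum_prod_type_right]; simp
    have h2 : ∀ a : Fin m, ∑ q : Fin m × Fin m, (if q.2 = a then (1 : ℝ) else 0) = m :=
      fun a => by rw [Fintype.sum_prod_type]; simp
    simp only [g, ← Finset.mul_sum, Finset.sum_add_distrib, h1, h2]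
    ring
  calc _ ≤ ∑ p ∈ (Finset.univ : Finset (Fin m)).offDiag,
        ∑ q ∈ (Finset.univ : Finset (Fin m)).offDiag, g p q := by
        refine Finset.sum_le_sum fun p hp => Finset.sum_le_sum fun q hq => ?_
        simp only [Finset.mem_offDiag, Finset.mem_univ, true_and] at hp hq
        by_cases h : q.1 ≠ p.1 ∧ q.1 ≠ p.2 ∧ q.2 ≠ p.1 ∧ q.2 ≠ p.2
        · rw [hW.covariance_inner_sq_eq_zero h]
          exact hg0 p q
        · refine (hW.covariance_inner_sq_le hp hq).trans ?_
          rw [← hβ]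
          refine le_mul_of_one_le_right hβ0 ?_
          have hn : ∀ (s : Prop) [Decidable s], (0 : ℝ) ≤ if s then 1 else 0 :=
            fun s _ => by positivity
          have n1 := hn (q.1 = p.1)
          have n2 := hn (q.1 = p.2)
          have n3 := hn (q.2 = p.1)
          have n4 := hn (q.2 = p.2)
          have h' : q.1 = p.1 ∨ q.1 = p.2 ∨ q.2 = p.1 ∨ q.2 = p.2 := by tauto
          rcases h' with h | h | h | h
          · rw [if_pos h]; linarith
          · rw [if_pos h]; linarith
          · rw [if_pos h]; linarith
          · rw [if_pos h]; linarith
    _ ≤ ∑ p : Fin m × Fin m, ∑ q : Fin m × Fin m, g p q := by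
        refine (Finset.sum_le_sum fun p _ => Finset.sum_le_univ_sum_of_nonneg (hg0 p)).trans ?_
        exact Finset.sum_le_univ_sum_of_nonneg fun p => Finset.sum_nonneg fun q _ => hg0 p q
    _ = _ := by
        simp_rw [hg]
        simp
        ring

theorem integral_offDiag_le (hW : IsGaussianMatrix P v W) :
    ∫ ω, ∑ p ∈ (Finset.univ : Finset (Fin m)).offDiag, (∑ l, W ω p.1 l * W ω p.2 l) ^ 2 ∂P ≤
      (m : ℝ) ^ 2 * (k * (v : ℝ) ^ 2) := by
  rw [integral_finsetSum _ fun p _ => (hW.hasMoments_inner_sq p).integrable]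
  have h : ∀ p ∈ (Finset.univ : Finset (Fin m)).offDiag,
      ∫ ω, (∑ l, W ω p.1 l * W ω p.2 l) ^ 2 ∂P = k * (v : ℝ) ^ 2 := fun p hp => by
    simp only [Finset.mem_offDiag, Finset.mem_univ, true_and] at hp
    simpa using (hW.rows_inner hp Finset.univ).2.1
  rw [Finset.sum_congr rfl h, Finset.sum_const, nsmul_eq_mul, Finset.offDiag_card]
  gcongr
  simp only [Finset.card_univ, Fintype.card_fin]
  calc ((m * m - m : ℕ) : ℝ) ≤ ((m * m : ℕ) : ℝ) := by exact_mod_cast Nat.sub_le _ _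
    _ = _ := by push_cast; ring

/-- Lower deviations of the squared Frobenius norm. -/
theorem prob_frob_small (hW : IsGaussianMatrix P v W) (hm : 0 < m) (hk : 0 < k) (hv : 0 < v) :
    P.real {ω | ∑ i, ∑ j, W ω i j ^ 2 ≤ m * k * v / 2} ≤ 4 * gaussFourth / (m * k) := by
  obtain ⟨h1, h2⟩ := hW.sum_sq Finset.univ
  have hm' : (0 : ℝ) < m := by exact_mod_cast hm
  have hk' : (0 : ℝ) < k := by exact_mod_cast hk
  have hv' : (0 : ℝ) < v := by exact_mod_cast hv
  have hmom : HasMoments P (fun ω => ∑ p : Fin m × Fin k, W ω p.1 p.2 ^ 2) :=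
    HasMoments.sum _ fun p _ => (hW.hasMoments p.1 p.2).pow 2
  have h := prob_abs_sub_ge_le hmom h2 (δ := m * k * v / 2) (by positivity)
  rw [h1] at h
  simp only [Finset.card_univ, Fintype.card_prod, Fintype.card_fin, Nat.cast_mul] at h
  refine (measureReal_mono ?_).trans (h.trans (le_of_eq ?_))
  · intro ω hω
    simp only [Set.mem_ofPred_eq, Fintype.sum_prod_type] at hω ⊢
    rw [abs_sub_comm]
    refine le_trans ?_ (le_abs_self _)
    linarith
  · field_simp
    ring

/-- Markov's inequality for the energy of few columns in a rotated basis. -/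
theorem prob_first_cols_large (hW : IsGaussianMatrix P v W) {U : Matrix (Fin k) (Fin k) ℝ}
    (hU : Uᵀ * U = 1) (r : ℕ) {δ : ℝ} (hδ : 0 < δ) :
    P.real {ω | δ ≤ ∑ j : {j : Fin k // ¬ r ≤ (j : ℕ)}, ∑ i, (W ω * U) i j ^ 2} ≤
      r * (m * v) / δ := by
  have hmom : ∀ i j, HasMoments P (fun ω => (W ω * U) i j ^ 2) := fun i j => by
    simp only [Matrix.mul_apply]
    exact (HasMoments.sum _ fun l _ => (hW.hasMoments i l).mul (HasMoments.const _)).pow 2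
  have hint : ∀ i j, ∫ ω, (W ω * U) i j ^ 2 ∂P = v := fun i j => by
    have h := congrFun (congrFun hU j) j
    rw [Matrix.mul_apply, Matrix.one_apply_eq] at h
    simp only [Matrix.mul_apply]
    rw [hW.integral_row_sq i (fun l => U l j)]
    simp only [Matrix.transpose_apply, ← sq] at h
    rw [h, mul_one]
  have hcol : ∀ j : {j : Fin k // ¬ r ≤ (j : ℕ)},
      HasMoments P (fun ω => ∑ i, (W ω * U) i j ^ 2) :=
    fun j => HasMoments.sum _ fun i _ => hmom i j
  refine prob_ge_le (HasMoments.sum _ fun j _ => hcol j)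
    (fun ω => Finset.sum_nonneg fun _ _ => Finset.sum_nonneg fun _ _ => sq_nonneg _) ?_ hδ
  rw [integral_finsetSum _ fun j _ => (hcol j).integrable]
  simp_rw [integral_finsetSum _ fun i _ => (hmom i _).integrable, hint]
  simp only [Finset.sum_const, Finset.card_univ, Fintype.card_fin, nsmul_eq_mul]
  gcongr
  exact card_first_le k r

/-- Markov's inequality for the fluctuations of the row norms. -/
theorem prob_rows_large (hW : IsGaussianMatrix P v W) {δ : ℝ} (hδ : 0 < δ) :
    P.real {ω | δ ≤ ∑ i, (∑ l, W ω i l ^ 2 - k * v) ^ 2} ≤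
      m * (k * (gaussFourth * (v : ℝ) ^ 2)) / δ := by
  have hrow : ∀ i, HasMoments P (fun ω => ∑ l, W ω i l ^ 2) := fun i =>
    HasMoments.sum _ fun l _ => (hW.hasMoments i l).pow 2
  have hmom : ∀ i, HasMoments P (fun ω => (∑ l, W ω i l ^ 2 - k * v) ^ 2) := fun i =>
    ((hrow i).sub_const _).pow 2
  refine prob_ge_le (HasMoments.sum _ fun i _ => hmom i)
    (fun ω => Finset.sum_nonneg fun _ _ => sq_nonneg _) ?_ hδ
  rw [integral_finsetSum _ fun i _ => (hmom i).integrable]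
  have key : ∀ i, ∫ ω, (∑ l, W ω i l ^ 2 - k * v) ^ 2 ∂P ≤
      k * (gaussFourth * (v : ℝ) ^ 2) := by
    intro i
    obtain ⟨h1, h2⟩ := hW.sum_sq
      (Finset.univ.map ⟨fun l : Fin k => (i, l), Prod.mk_right_injective i⟩)
    simp only [Finset.sum_map, Function.Embedding.coeFn_mk, Finset.card_map, Finset.card_univ,
      Fintype.card_fin] at h1 h2
    rw [variance_eq_integral (hrow i).integrable.aemeasurable, h1] at h2
    exact h2
  refine (Finset.sum_le_sum fun i _ => key i).trans (le_of_eq ?_)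
  simp

/-- Upper deviations of the sum of squared inner products of distinct rows. -/
theorem prob_offDiag_large (hW : IsGaussianMatrix P v W) {δ : ℝ} (hδ : 0 < δ) :
    P.real {ω | (m : ℝ) ^ 2 * (k * (v : ℝ) ^ 2) + δ ≤
      ∑ p ∈ (Finset.univ : Finset (Fin m)).offDiag, (∑ l, W ω p.1 l * W ω p.2 l) ^ 2} ≤
      4 * (m : ℝ) ^ 3 * ((k * gaussFourth ^ 2 + 3 * (k : ℝ) ^ 2) * (v : ℝ) ^ 4) / δ ^ 2 := by
  refine (measureReal_mono ?_).trans (prob_abs_sub_ge_le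
    (HasMoments.sum _ fun p _ => hW.hasMoments_inner_sq p) hW.variance_offDiag_le hδ)
  intro ω hω
  simp only [Set.mem_ofPred_eq] at hω ⊢
  refine le_trans ?_ (le_abs_self _)
  linarith [hW.integral_offDiag_le]

/-- With high probability a Gaussian matrix has large energy outside few directions and a small
fourth Schatten norm. -/
theorem prob_good_ge (hW : IsGaussianMatrix P v W) (hm : 0 < m) (hk : 0 < k) (hv : 0 < v)
    {U : Matrix (Fin k) (Fin k) ℝ} (hU : Uᵀ * U = 1) (r : ℕ) {δ : ℝ} (hδ : 0 < δ) :
    1 - (4 * gaussFourth / (m * k) + 4 * r / k + m * (k * (gaussFourth * (v : ℝ) ^ 2)) / δ +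
      4 * (m : ℝ) ^ 3 * ((k * gaussFourth ^ 2 + 3 * (k : ℝ) ^ 2) * (v : ℝ) ^ 4) / δ ^ 2) ≤
    P.real {ω | m * k * v / 4 ≤ frobNorm (lastCols r (W ω * U)) ^ 2 ∧
      ∑ i, ∑ j, (∑ l, W ω i l * W ω j l) ^ 2 ≤
        2 * (m * (k * v) ^ 2) + (m : ℝ) ^ 2 * (k * (v : ℝ) ^ 2) + 3 * δ} := by
  have hm' : (0 : ℝ) < m := by exact_mod_cast hm
  have hk' : (0 : ℝ) < k := by exact_mod_cast hk
  have hv' : (0 : ℝ) < v := by exact_mod_cast hv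
  have hU' : U * Uᵀ = 1 := mul_eq_one_comm.mp hU
  have b1 := hW.prob_frob_small hm hk hv
  -- At least half the mean energy in total, minus less than a quarter in the first `r` columns,
  -- leaves a quarter for the bulk.
  have b2 := hW.prob_first_cols_large hU r (δ := m * k * v / 4) (by positivity)
  have b3 := hW.prob_rows_large hδ
  have b4 := hW.prob_offDiag_large hδ
  rw [show (r : ℝ) * (m * v) / (m * k * v / 4) = 4 * r / k by field_simp] at b2
  set B1 := {ω | ∑ i, ∑ j, W ω i j ^ 2 ≤ m * k * v / 2}
  set B2 := {ω | m * k * v / 4 ≤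
    ∑ j : {j : Fin k // ¬ r ≤ (j : ℕ)}, ∑ i, (W ω * U) i j ^ 2}
  set B3 := {ω | δ ≤ ∑ i, (∑ l, W ω i l ^ 2 - k * v) ^ 2}
  set B4 := {ω | (m : ℝ) ^ 2 * (k * (v : ℝ) ^ 2) + δ ≤
      ∑ p ∈ (Finset.univ : Finset (Fin m)).offDiag, (∑ l, W ω p.1 l * W ω p.2 l) ^ 2}
  set T := {ω | m * k * v / 4 ≤ frobNorm (lastCols r (W ω * U)) ^ 2 ∧
      ∑ i, ∑ j, (∑ l, W ω i l * W ω j l) ^ 2 ≤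
        2 * (m * (k * v) ^ 2) + (m : ℝ) ^ 2 * (k * (v : ℝ) ^ 2) + 3 * δ}
  -- Covering the whole space and using subadditivity avoids any measurability of these events.
  have hcover : (Set.univ : Set Ω) ⊆ T ∪ (B1 ∪ (B2 ∪ (B3 ∪ B4))) := by
    intro ω _
    by_contra hω
    simp only [Set.mem_union, not_or] at hω
    obtain ⟨hT, h1, h2, h3, h4⟩ := hω
    refine hT ⟨?_, ?_⟩
    · simp only [B1, B2, Set.mem_ofPred_eq, not_le] at h1 h2
      have hs := sum_sq_split r (W ω * U)
      have hrot : ∑ i, ∑ j, (W ω * U) i j ^ 2 = ∑ i, ∑ j, W ω i j ^ 2 := by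
        rw [← frobNorm_sq, ← frobNorm_sq, frobNorm_sq_eq_trace, frobNorm_sq_eq_trace,
          Matrix.transpose_mul, Matrix.mul_assoc, Matrix.trace_mul_comm, Matrix.mul_assoc,
          Matrix.mul_assoc, hU', Matrix.mul_one]
      rw [hrot] at hs
      linarith
    · simp only [B3, B4, Set.mem_ofPred_eq, not_le] at h3 h4
      have hsplit : ∑ i, ∑ j, (∑ l, W ω i l * W ω j l) ^ 2 =
          ∑ i, (∑ l, W ω i l ^ 2) ^ 2 +
          ∑ p ∈ (Finset.univ : Finset (Fin m)).offDiag, (∑ l, W ω p.1 l * W ω p.2 l) ^ 2 := by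
        rw [← Finset.sum_product', ← Finset.diag_union_offDiag,
          Finset.sum_union (Finset.disjoint_diag_offDiag _), Finset.sum_diag]
        simp only [sq]
      -- The doubled row fluctuations use `2 * δ` of the allowance `3 * δ`; the off-diagonal part
      -- uses the remaining `δ`.
      have hdiag : ∑ i, (∑ l, W ω i l ^ 2) ^ 2 ≤
          2 * (m * (k * v) ^ 2) + 2 * ∑ i, (∑ l, W ω i l ^ 2 - k * v) ^ 2 := by
        have : ∀ i, (∑ l, W ω i l ^ 2) ^ 2 ≤
            2 * (k * v) ^ 2 + 2 * (∑ l, W ω i l ^ 2 - k * v) ^ 2 := fun i => by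
          nlinarith [sq_nonneg (∑ l, W ω i l ^ 2 - 2 * (k * v))]
        refine (Finset.sum_le_sum fun i _ => this i).trans (le_of_eq ?_)
        simp only [Finset.sum_add_distrib, Finset.sum_const, Finset.card_univ, Fintype.card_fin,
          nsmul_eq_mul, ← Finset.mul_sum]
        ring
      linarith
  have hone : (1 : ℝ) ≤ P.real T + (P.real B1 + (P.real B2 + (P.real B3 + P.real B4))) := by
    calc (1 : ℝ) = P.real Set.univ := by simp
      _ ≤ P.real (T ∪ (B1 ∪ (B2 ∪ (B3 ∪ B4)))) := measureReal_mono hcover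
      _ ≤ _ := by
        refine (measureReal_union_le _ _).trans (add_le_add_right ?_ _)
        refine (measureReal_union_le _ _).trans (add_le_add_right ?_ _)
        refine (measureReal_union_le _ _).trans (add_le_add_right ?_ _)
        exact measureReal_union_le _ _
  linarith

end IsGaussianMatrix

end Concentration

/-! ### Asymptotics in the proportional regime. -/

theorem eventually_div_rpow_le (a : ℝ) {u : ℝ} (hu : 0 < u) :
    ∀ᶠ d : ℕ in atTop, a / (d : ℝ) ^ u ≤ 1 / 2 := by
  have h : Tendsto (fun d : ℕ => a / (d : ℝ) ^ u) atTop (𝓝 0) :=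
    tendsto_const_nhds.div_atTop ((tendsto_rpow_atTop hu).comp tendsto_natCast_atTop_atTop)
  exact h.eventually (eventually_le_nhds (by norm_num))

theorem gram_isSymm {k n : ℕ} (A : Matrix (Fin k) (Fin n) ℝ) : (gram A).IsSymm := by
  simp [Matrix.IsSymm, gram, Matrix.transpose_mul]

/-- In the proportional regime the failure probability tends to zero. -/
theorem tendsto_failure (κ₁ κ Γ : ℝ) {ρ : ℕ → ℝ} (hρ : Tendsto ρ atTop (𝓝 0)) :
    Tendsto (fun d : ℕ => 4 * Γ / (κ₁ ^ 2 * d) + 4 * ρ d / κ₁ + κ ^ 2 * Γ / d +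
      4 * κ ^ 3 * (κ * Γ ^ 2 + 3 * κ ^ 2) / d) atTop (𝓝 0) := by
  have h : ∀ a : ℝ, Tendsto (fun d : ℕ => a / (d : ℝ)) atTop (𝓝 0) := fun a =>
    tendsto_const_nhds.div_atTop tendsto_natCast_atTop_atTop
  have h1 := h (4 * Γ / κ₁ ^ 2)
  have h2 : Tendsto (fun d => 4 * ρ d / κ₁) atTop (𝓝 0) := by
    simpa using (hρ.const_mul 4).div_const κ₁
  have := ((h1.add h2).add (h (κ ^ 2 * Γ))).add (h (4 * κ ^ 3 * (κ * Γ ^ 2 + 3 * κ ^ 2)))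
  simpa only [add_zero, div_div] using this

/-- Evaluates the failure probability of `prob_good_ge` at `v = 1/d`, `δ = d`. Inserting factors `d
≥ 1` gives all terms except the one in `ρ` the order `1/d`. -/
theorem failure_le {κ₁ κ Γ ρ : ℝ} (hκ₁ : 0 < κ₁) (hκ : 0 ≤ κ) (hΓ : 0 ≤ Γ)
    {d m k r : ℕ} (hd : 1 ≤ d)
    (hm : κ₁ * d ≤ m) (hm' : (m : ℝ) ≤ κ * d) (hk : κ₁ * d ≤ k) (hk' : (k : ℝ) ≤ κ * d)
    (hr : (r : ℝ) ≤ ρ * d) :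
    4 * Γ / (m * k) + 4 * r / k + m * (k * (Γ * (1 / (d : ℝ)) ^ 2)) / d +
      4 * (m : ℝ) ^ 3 * ((k * Γ ^ 2 + 3 * (k : ℝ) ^ 2) * (1 / (d : ℝ)) ^ 4) / (d : ℝ) ^ 2 ≤
    4 * Γ / (κ₁ ^ 2 * d) + 4 * ρ / κ₁ + κ ^ 2 * Γ / d +
      4 * κ ^ 3 * (κ * Γ ^ 2 + 3 * κ ^ 2) / d := by
  have hd1 : (1 : ℝ) ≤ d := by exact_mod_cast hd
  have hd0 : (0 : ℝ) < d := by linarith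
  have hk0 : (0 : ℝ) < k := lt_of_lt_of_le (by positivity) hk
  have hρ : 0 ≤ ρ * d := (Nat.cast_nonneg r).trans hr
  refine add_le_add (add_le_add (add_le_add ?_ ?_) ?_) ?_
  · have : κ₁ ^ 2 * d ≤ m * k := by
      calc κ₁ ^ 2 * d ≤ κ₁ ^ 2 * d * d := le_mul_of_one_le_right (by positivity) hd1
        _ = (κ₁ * d) * (κ₁ * d) := by ring
        _ ≤ m * k := by gcongr
    gcongr
  · calc 4 * (r : ℝ) / k ≤ 4 * (ρ * d) / (κ₁ * d) := by gcongr
      _ = 4 * ρ / κ₁ := by field_simp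
  · calc (m : ℝ) * (k * (Γ * (1 / (d : ℝ)) ^ 2)) / d
        ≤ κ * d * (κ * d * (Γ * (1 / (d : ℝ)) ^ 2)) / d := by gcongr
      _ = _ := by field_simp
  · calc 4 * (m : ℝ) ^ 3 * ((k * Γ ^ 2 + 3 * (k : ℝ) ^ 2) * (1 / (d : ℝ)) ^ 4) / (d : ℝ) ^ 2
        ≤ 4 * (κ * d) ^ 3 * ((κ * d * Γ ^ 2 * d + 3 * (κ * d) ^ 2) * (1 / (d : ℝ)) ^ 4) /
          (d : ℝ) ^ 2 := by
          have : (k : ℝ) * Γ ^ 2 ≤ κ * d * Γ ^ 2 * d := by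
            calc (k : ℝ) * Γ ^ 2 ≤ κ * d * Γ ^ 2 := by gcongr
              _ ≤ _ := le_mul_of_one_le_right (by positivity) hd1
          gcongr
      _ = _ := by field_simp

end MultiSpike

end

/-! ### Assembly of the theorem. -/

theorem mainTheorem5 (c₁ c₂ c ℓ u : ℝ) (hc₁ : 0 < c₁) (hc₁₂ : c₁ ≤ c₂) (hc : 1 ≤ c)
    (hℓ : 0 < ℓ) (hu : 0 < u) :
    ∃ C₁ : ℝ, 0 < C₁ ∧ ∀ C₂ : ℝ, 0 < C₂ →
      -- the two deterministic estimates
      (∀ K : ℝ, ∃ a b : ℝ, 0 < a ∧ 0 < b ∧ ∀ᶠ d : ℕ in atTop,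
        ∀ (m k n r : ℕ) (A : Matrix (Fin k) (Fin n) ℝ) (Wsharp : Matrix (Fin m) (Fin k) ℝ)
          (U : Matrix (Fin k) (Fin k) ℝ),
          MultiSpike.MultiSpiked c₁ c₂ ℓ u d r (MultiSpike.gram A) →
          c₁ * (d : ℝ) ^ u ≤ MultiSpike.opNorm (MultiSpike.gram A) →
          MultiSpike.opNorm Wsharp ≤ K →
          MultiSpike.IsOrderedEigenbasis (MultiSpike.gram A) U →
          ∀ t : ℕ, MultiSpike.InWindow C₁ C₂ ℓ u d t →
            a * (MultiSpike.nucNorm (MultiSpike.lastCols r (Wsharp * U)) - r) ≤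
                MultiSpike.nucNorm (MultiSpike.gradAt c A Wsharp t) ∧
              MultiSpike.frobNorm (MultiSpike.gradAt c A Wsharp t) ≤
                b * (MultiSpike.frobNorm (MultiSpike.lastCols r (Wsharp * U)) + √(r : ℝ))) ∧
      -- Gaussian ground truth, for fixed `A`, with `m ≍ k ≍ d` and `r = o(d)`
      (∀ κ₁ κ₂ : ℝ, 0 < κ₁ → ∃ C₃ : ℝ, 0 < C₃ ∧
        ∀ ρ : ℕ → ℝ, Tendsto ρ atTop (𝓝 0) → ∀ ε : ℝ, 0 < ε → ∀ᶠ d : ℕ in atTop,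
          ∀ (m k n r : ℕ) (A : Matrix (Fin k) (Fin n) ℝ),
            κ₁ * d ≤ m → (m : ℝ) ≤ κ₂ * d → κ₁ * d ≤ k → (k : ℝ) ≤ κ₂ * d →
            (r : ℝ) ≤ ρ d * d →
            MultiSpike.MultiSpiked c₁ c₂ ℓ u d r (MultiSpike.gram A) →
            c₁ * (d : ℝ) ^ u ≤ MultiSpike.opNorm (MultiSpike.gram A) →
            ∀ (Ω : Type*) [MeasurableSpace Ω] (P : Measure Ω) [IsProbabilityMeasure P]
              (W : Ω → Matrix (Fin m) (Fin k) ℝ),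
              MultiSpike.IsGaussianMatrix P (1 / (d : ℝ≥0)) W →
              1 - ε ≤ P.real {ω | ∀ t : ℕ, MultiSpike.InWindow C₁ C₂ ℓ u d t →
                C₃ * d ≤ MultiSpike.nuclearRank (MultiSpike.gradAt c A (W ω) t)}) := by
  have hc₂ : 0 < c₂ := hc₁.trans_le hc₁₂
  have hc0 : 0 < c := by linarith
  refine ⟨2 * c * c₂ * u / c₁, by positivity, fun C₂ _ => ?_⟩
  set a := c₁ * Real.exp (-(2 * (c₂ / (c * c₁) * C₂))) with ha_def
  have ha : 0 < a := by positivity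
  have hlarge := MultiSpike.eventually_div_rpow_le (c₂ / (c * c₁)) hu
  -- The sign of `K` is not prescribed, hence `|K|`, which keeps `b` positive.
  refine ⟨fun K => ⟨a, 2 * c₂ * (|K| + 1), ha, by positivity, ?_⟩, fun κ₁ κ₂ hκ₁ => ?_⟩
  · filter_upwards [hlarge, eventually_ge_atTop 1] with d hd' hd m k n r A W U hA hop hK hU t ht
    obtain ⟨D, hD, hDa, hG⟩ :=
      MultiSpike.gradAt_window (m := m) hc₁ hc₁₂ hc hu hd hd' hA hop hU ht
    have hU1 : Uᵀ * U = 1 := (Matrix.mem_orthogonalGroup_iff' _ _).mp hU.1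
    have hU2 : U * Uᵀ = 1 := (Matrix.mem_orthogonalGroup_iff _ _).mp hU.1
    rw [hG]
    constructor
    · refine le_trans ?_ (MultiSpike.nucNorm_lastCols_le (W * U) D hU1 hU2 r ha hDa)
      -- Subtracting `r` only weakens the bound: `a * nucNorm` of the bulk block is already a lower
      -- bound.
      gcongr
      simp
    · exact MultiSpike.frobNorm_filtered_le hU1 W (by positivity) (hK.trans (le_abs_self K)) r hD
  -- Diagonal terms give `2 |κ₂|³ d`, off-diagonal ones `|κ₂|³ d`, and the allowance `3 * δ` with `δ
  -- = d` gives `3 d`.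
  · set y := 3 * |κ₂| ^ 3 + 3 with hy
    refine ⟨(a ^ 2 * (κ₁ ^ 2 / 4)) ^ 2 / ((2 * c₂) ^ 4 * y), by positivity, ?_⟩
    intro ρ hρ ε hε
    have hfail := (MultiSpike.tendsto_failure κ₁ |κ₂| MultiSpike.gaussFourth hρ).eventually
      (eventually_le_nhds hε)
    filter_upwards [hlarge, eventually_ge_atTop 1, hfail] with d hd' hd hfail m k n r A hm1 hm2
      hk1 hk2 hr hA hop Ω _ P _ W hW
    have hd1 : (1 : ℝ) ≤ d := by exact_mod_cast hd
    have hd0 : (0 : ℝ) < d := by linarith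
    have hm2' : (m : ℝ) ≤ |κ₂| * d := hm2.trans (by gcongr; exact le_abs_self _)
    have hk2' : (k : ℝ) ≤ |κ₂| * d := hk2.trans (by gcongr; exact le_abs_self _)
    have hm0 : 0 < m := by
      have : (0 : ℝ) < m := lt_of_lt_of_le (by positivity) hm1
      exact_mod_cast this
    have hk0 : 0 < k := by
      have : (0 : ℝ) < k := lt_of_lt_of_le (by positivity) hk1
      exact_mod_cast this
    -- The eigenbasis depends on `A` alone, so it is fixed before the randomness enters.
    obtain ⟨U, hU⟩ := MultiSpike.exists_orderedEigenbasis (MultiSpike.gram_isSymm A)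
    have hU1 : Uᵀ * U = 1 := (Matrix.mem_orthogonalGroup_iff' _ _).mp hU.1
    have hv : (0 : ℝ≥0) < 1 / (d : ℝ≥0) := by positivity
    have hgood := hW.prob_good_ge hm0 hk0 hv hU1 r hd0
    have hcoe : ((1 / (d : ℝ≥0) : ℝ≥0) : ℝ) = 1 / (d : ℝ) := by simp
    rw [hcoe] at hgood
    have hf := MultiSpike.failure_le hκ₁ (abs_nonneg κ₂) MultiSpike.gaussFourth_nonneg hd hm1
      hm2' hk1 hk2' hr
    refine le_trans (by linarith) (hgood.trans (measureReal_mono ?_))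
    -- The good event does not mention `t`; every time in the window is handled on it
    -- deterministically.
    rintro ω ⟨hF, hQ⟩ t ht
    obtain ⟨D, hD, hDa, hG⟩ :=
      MultiSpike.gradAt_window (m := m) hc₁ hc₁₂ hc hu hd hd' hA hop hU ht
    rw [hG]
    have hx : κ₁ ^ 2 / 4 * d ≤ m * k * (1 / (d : ℝ)) / 4 := by
      calc κ₁ ^ 2 / 4 * d = (κ₁ * d) * (κ₁ * d) * (1 / (d : ℝ)) / 4 := by field_simp
        _ ≤ _ := by gcongr
    have hyd : 2 * ((m : ℝ) * (k * (1 / (d : ℝ))) ^ 2) +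
        (m : ℝ) ^ 2 * (k * (1 / (d : ℝ)) ^ 2) + 3 * d ≤ y * d := by
      calc _ ≤ 2 * (|κ₂| * d * (|κ₂| * d * (1 / (d : ℝ))) ^ 2) +
            (|κ₂| * d) ^ 2 * (|κ₂| * d * (1 / (d : ℝ)) ^ 2) + 3 * d := by gcongr
        _ = y * d := by rw [hy]; field_simp; ring
    have h := MultiSpike.nuclearRank_filtered_ge hU1 (W ω) ha r hD hDa
      (x := κ₁ ^ 2 / 4 * d) (by positivity) (hx.trans hF) (hQ.trans hyd)
    refine le_trans (le_of_eq ?_) h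
    field_simp
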